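/- Let $\mathbf x=(x_1,x_2,\dots)$, $\mathbf t=(t_1,t_2,\dots)$. For $f\in\mathbb Z[\mathbf t][\mathbf x]$ and $i\ge 1$ put $$R_i^-f=f(x_1,\dots,x_{i-1},t_i,x_i,x_{i+1},\dots;\mathbf t),\qquad R_i^+f=f(x_1,\dots,x_{i-1},x_i,t_i,x_{i+1},\dots;\mathbf t),\qquad E_if=\frac{R_i^+f-R_i^-f}{x_i-t_i}.$$ For $n\ge 0$ let $\mathrm{EQSym}_n$ be the $\mathbb Z[\mathbf t]$-algebra of equivariantly quasisymmetric polynomials, i.e. of those $f\in\mathbb Z[\mathbf t][x_1,\dots,x_n]$ with $R_i^+f=R_i^-f$ for $1\le i<n$. An indexed forest $F$ is a sequence $(T_1,T_2,\dots)$ of binary plane trees, all but finitely many of which consist of a single leaf; $\emptyset$ is the forest all of whose trees are single leaves. The leaves of $F$ are labelled $1,2,3,\dots$ from left to right. For an internal node $v$ let $\rho_F(v)$ be the label of the leaf reached from $v$ by going down left edges. The code of $F$ is the sequence $(c_i)_{i\ge1}$, $c_i=\#\{v:\rho_F(v)=i\}$. Let $\mathrm{QDes}(F)=\{\rho_F(v):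 v\text{ an internal node both of whose children are leaves}\}$, and for $i\in \mathrm{QDes}(F)$ let $F/i$ be the forest obtained by replacing the node $v$ with both children leaves and $\rho_F(v)=i$ by a leaf. Let $\mathrm{Zig}_n$ be the set of zigzag forests, those with $\mathrm{QDes}(F)\subseteq\{n\}$ (so $\mathrm{Zig}_0=\{\emptyset\}$). The double forest polynomials $\mathfrak P_F(\mathbf x;\mathbf t)$ are the unique family of homogeneous polynomials in $\mathbb Z[\mathbf t][\mathbf x]$, indexed by the indexed forests $F$, with $\mathfrak P_\emptyset(\mathbf t;\mathbf t)=1$, $\mathfrak P_F(\mathbf t;\mathbf t)=0$ for $F\neq\emptyset$, and $E_i\mathfrak P_F=\mathfrak P_{F/i}(\mathbf x;t_1,\dots,t_{i-1},t_{i+1},\dots)$ if $i\in\mathrm{QDes}(F)$, $E_i\mathfrak P_F=0$ otherwise. A padded composition of length $n$ is a sequence $c=(0^{n-\ell},a_1,\dots,a_\ell)$ with $0\le\ell\le n$ and all $a_j>0$. Let $F_c$ be the unique indexed forest whose code is $c$ followed by zeros. Let $\mathfrak F_c(\mathbf x_n;\mathbf t)=\mathfrak P_{F_c}(\mathbf x;\mathbf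 t)$ be the double fundamental quasisymmetric polynomial. With $m=a_1+\dots+a_\ell$ and $\mathrm{Set}(c)=\{a_1,a_1+a_2,\dots,a_1+\dots+a_{\ell-1}\}$, the ordinary fundamental quasisymmetric polynomial is $$\mathfrak F_c(\mathbf x_n)=\sum_{\substack{1\le i_1\le\dots\le i_m\le n\\ j\in\mathrm{Set}(c)\Rightarrow i_j<i_{j+1}}}x_{i_1}\cdots x_{i_m}.$$ **Theorem.** The family $(\mathfrak P_F)_F$ exists and is unique, and for every padded composition $c$ the forest $F_c$ exists and is unique. For every $n\ge0$: 1. $\mathfrak F_c(\mathbf x_n;\mathbf 0)=\mathfrak F_c(\mathbf x_n)$ for every padded composition $c$ of length $n$; 2. $\{\mathfrak P_F(\mathbf x;\mathbf t): F\in\mathrm{Zig}_n\}=\{\mathfrak F_c(\mathbf x_n;\mathbf t): c\text{ a padded composition of length } n\}$, and this set is a $\mathbb Z[\mathbf t]$-basis of $\mathrm{EQSym}_n$: each of the families $(\mathfrak P_F)_{F\in\mathrm{Zig}_n}$ and $(\mathfrak F_c)_c$ is a basis. -/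

import Mathlib

noncomputable section

namespace EQSymPoly

open MvPolynomial

/-! Indexing convention: all the index sets that are written `1, 2, 3, …` on paper are `0, 1, 2, …`
here.  Thus `X i` is the variable `x_{i+1}`, `tvar i` is `t_{i+1}`, leaf `i` of a forest is the leaf
labelled `i + 1`, and the operators with index `i` are those with index `i + 1` on paper. -/

/-- The coefficient ring `ℤ[t]`, `t = (t₁, t₂, …)`. -/
abbrev CoeffT : Type := MvPolynomial ℕ ℤ

/-- The polynomial ring `ℤ[t][x]`, `x = (x₁, x₂, …)`, `t = (t₁, t₂, …)`. -/
abbrev PolyTX : Type := MvPolynomial ℕ CoeffT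

/-- The equivariant variable `t_{i+1}`, as an element of `ℤ[t]`. -/
def tvar (i : ℕ) : CoeffT := X i

/-! ### Equivariantly quasisymmetric polynomials -/

/-- The equivariant Bergeron–Sottile map `R_i^-`:
`f(x; t) ↦ f(x_1, …, x_{i-1}, t_i, x_i, x_{i+1}, …; t)`. -/
def rMinus (i : ℕ) : PolyTX →ₐ[CoeffT] PolyTX :=
  aeval fun j => if j < i then X j else if j = i then C (tvar i) else X (j - 1)

/-- The equivariant Bergeron–Sottile map `R_i^+`:
`f(x; t) ↦ f(x_1, …, x_{i-1}, x_i, t_i, x_{i+1}, …; t)`. -/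
def rPlus (i : ℕ) : PolyTX →ₐ[CoeffT] PolyTX :=
  aeval fun j => if j ≤ i then X j else if j = i + 1 then C (tvar i) else X (j - 1)

/-- The `ℤ[t]`-algebra `EQSym_n` of equivariantly quasisymmetric polynomials: those
`f ∈ ℤ[t][x_1, …, x_n]` with `R_i^+ f = R_i^- f` for `1 ≤ i < n`. -/
def eqsym (n : ℕ) : Subalgebra CoeffT PolyTX where
  carrier := {f | f ∈ supported CoeffT {i : ℕ | i < n} ∧
    ∀ i : ℕ, i + 1 < n → rPlus i f = rMinus i f}
  mul_mem' := fun ha hb =>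
    ⟨mul_mem ha.1 hb.1, fun i hi => by rw [map_mul, map_mul, ha.2 i hi, hb.2 i hi]⟩
  add_mem' := fun ha hb =>
    ⟨add_mem ha.1 hb.1, fun i hi => by rw [map_add, map_add, ha.2 i hi, hb.2 i hi]⟩
  algebraMap_mem' := fun r =>
    ⟨Subalgebra.algebraMap_mem _ r, fun i _ => by rw [AlgHom.commutes, AlgHom.commutes]⟩

theorem sub_dvd_rPlus_sub_rMinus (i : ℕ) (f : PolyTX) :
    (X i - C (tvar i) : PolyTX) ∣ rPlus i f - rMinus i f := by
  rw [← Ideal.mem_span_singleton, ← Ideal.Quotient.mk_eq_mk_iff_sub_mem]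
  have hx : Ideal.Quotient.mk (Ideal.span {(X i - C (tvar i) : PolyTX)}) (X i) =
      Ideal.Quotient.mk (Ideal.span {(X i - C (tvar i) : PolyTX)}) (C (tvar i)) := by
    rw [Ideal.Quotient.mk_eq_mk_iff_sub_mem, Ideal.mem_span_singleton]
  have h : (Ideal.Quotient.mkₐ CoeffT (Ideal.span {(X i - C (tvar i) : PolyTX)})).comp (rPlus i) =
      (Ideal.Quotient.mkₐ CoeffT (Ideal.span {(X i - C (tvar i) : PolyTX)})).comp (rMinus i) := by
    apply MvPolynomial.algHom_ext
    intro j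
    simp only [AlgHom.comp_apply, rPlus, rMinus, aeval_X, Ideal.Quotient.mkₐ_eq_mk]
    rcases lt_trichotomy j i with hj | hj | hj
    · rw [if_pos hj.le, if_pos hj]
    · subst hj
      simpa using hx
    · rw [if_neg (show ¬ j ≤ i by omega), if_neg (show ¬ j < i by omega),
        if_neg (show ¬ j = i by omega)]
      by_cases h1 : j = i + 1
      · rw [if_pos h1, h1, Nat.add_sub_cancel]
        exact hx.symm
      · rw [if_neg h1]
  exact DFunLike.congr_fun h f

/-- The equivariant trimming operation (equivariant quasisymmetric divided difference)
`E_i f = (R_i^+ f - R_i^- f) / (x_i - t_i)`; the quotient is unique as `ℤ[t][x]` is a domain. -/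
def eope (i : ℕ) (f : PolyTX) : PolyTX := Classical.choose (sub_dvd_rPlus_sub_rMinus i f)

theorem eope_spec (i : ℕ) (f : PolyTX) :
    (X i - C (tvar i)) * eope i f = rPlus i f - rMinus i f :=
  (Classical.choose_spec (sub_dvd_rPlus_sub_rMinus i f)).symm

/-! ### Indexed forests

A binary plane tree is a `BinaryTree Unit`: `nil` is the trivial tree (a single leaf), and
`node () l r` is an internal node with left subtree `l` and right subtree `r`. -/

/-- The values `ρ(v)` of the flag (the label of the leaf reached from `v` by going down left edges)
over all internal nodes `v` of a tree whose leaves are labelled `o, o + 1, …` from left to right. -/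
def treeFlags : ℕ → BinaryTree Unit → Multiset ℕ
  | _, .nil => 0
  | o, .node _ l r => o ::ₘ (treeFlags o l + treeFlags (o + l.numLeaves) r)

/-- The values of the flag over the terminal nodes (both children are leaves) only. -/
def treeTerminalFlags : ℕ → BinaryTree Unit → Set ℕ
  | _, .nil => ∅
  | o, .node _ l r =>
    if l = .nil ∧ r = .nil then {o}
    else treeTerminalFlags o l ∪ treeTerminalFlags (o + l.numLeaves) r

/-- Delete (that is, turn into a leaf) the terminal node with flag value `i`, if there is one, in a
tree whose leaves are labelled `o, o + 1, …`. -/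
def treeTrim (i : ℕ) : ℕ → BinaryTree Unit → BinaryTree Unit
  | _, .nil => .nil
  | o, .node a l r =>
    if l = .nil ∧ r = .nil then (if o = i then .nil else .node a l r)
    else .node a (treeTrim i o l) (treeTrim i (o + l.numLeaves) r)

/-- An indexed forest: an infinite sequence of binary plane trees, all but finitely many trivial. -/
@[ext] structure IndexedForest where
  trees : ℕ → BinaryTree Unit
  finite_nontrivial : {k | trees k ≠ .nil}.Finite

namespace IndexedForest

/-- The empty forest, all of whose trees are trivial. -/
def empty : IndexedForest := ⟨fun _ => .nil, by simp⟩

instance : Inhabited IndexedForest := ⟨empty⟩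

/-- The label of the leftmost leaf of the `k`-th tree, when the leaves of the forest are labelled
`0, 1, 2, …` from left to right. -/
def firstLeaf (F : IndexedForest) (k : ℕ) : ℕ := ∑ j ∈ Finset.range k, (F.trees j).numLeaves

/-- The code: `c_i` is the number of internal nodes `v` of `F` with `ρ_F(v) = i`.  All the leaves of
the `k`-th tree have labels `≥ k`, so only the trees with `k ≤ i` contribute to `c_i`. -/
def code (F : IndexedForest) (i : ℕ) : ℕ :=
  ∑ k ∈ Finset.range (i + 1), (treeFlags (F.firstLeaf k) (F.trees k)).count i

/-- `QDes(F) = {ρ_F(v) | v a terminal node of F}`. -/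
def qdes (F : IndexedForest) : Set ℕ :=
  {i | ∃ k, i ∈ treeTerminalFlags (F.firstLeaf k) (F.trees k)}

/-- The trimmed forest `F/i` (used for `i ∈ QDes(F)`): delete the terminal node with flag `i`. -/
def trim (F : IndexedForest) (i : ℕ) : IndexedForest where
  trees k := treeTrim i (F.firstLeaf k) (F.trees k)
  finite_nontrivial := F.finite_nontrivial.subset fun k hk h => hk (by rw [h, treeTrim])

end IndexedForest

/-- The zigzag forests `Zig_n`: the forests with `QDes(F) ⊆ {n}` (labels starting from `1`). -/
def zigzag (n : ℕ) : Set IndexedForest := {F | ∀ i ∈ F.qdes, i + 1 = n}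

/-! ### Double forest polynomials -/

/-- The specialization `f(t; t) ∈ ℤ[t]` of `f(x; t)` at `x_i = t_i`. -/
def evalXT : PolyTX →ₐ[CoeffT] CoeffT := aeval tvar

/-- `f(x; t) ↦ f(x; t̂_i)`, where `t̂_i = (t_1, …, t_{i-1}, t_{i+1}, …)`. -/
def omitT (i : ℕ) : PolyTX →+* PolyTX :=
  map (rename (fun j => if j < i then j else j + 1) : CoeffT →ₐ[ℤ] CoeffT).toRingHom

/-- Homogeneity with respect to the total degree in all the variables `x` and `t` together. -/
def IsHomogeneousTX (f : PolyTX) : Prop :=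
  ∃ d : ℕ, ((sumAlgEquiv ℤ ℕ ℕ).symm f).IsHomogeneous d

/-- The characterization of the family of double forest polynomials. -/
structure IsDoubleForestFamily (P : IndexedForest → PolyTX) : Prop where
  homogeneous : ∀ F, IsHomogeneousTX (P F)
  normalized_empty : evalXT (P IndexedForest.empty) = 1
  normalized : ∀ F, F ≠ IndexedForest.empty → evalXT (P F) = 0
  eope_of_mem : ∀ F, ∀ i ∈ F.qdes, eope i (P F) = omitT i (P (F.trim i))
  eope_of_notMem : ∀ F, ∀ i ∉ F.qdes, eope i (P F) = 0

/-- The double forest polynomials `𝔓_F(x; t)`: the family with the above properties. -/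
def doubleForest : IndexedForest → PolyTX := Classical.epsilon IsDoubleForestFamily

/-! ### Padded compositions and (double) fundamental quasisymmetric polynomials -/

/-- The padded compositions of length `n`: sequences `(0^m, a_1, …, a_{n-m})` with all `a_i > 0`. -/
def padded (n : ℕ) : Set (Fin n → ℕ) := {c | ∃ m ≤ n, ∀ i : Fin n, 0 < c i ↔ m ≤ (i : ℕ)}

/-- Append zeros to a finite sequence, to get an infinite sequence. -/
def appendZeros {n : ℕ} (c : Fin n → ℕ) : ℕ → ℕ := fun i => if h : i < n then c ⟨i, h⟩ else 0

/-- The indexed forest `F_c` whose code is `c` (with zeros appended). -/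
def forestOf {n : ℕ} (c : Fin n → ℕ) : IndexedForest :=
  Classical.epsilon fun F => F.code = appendZeros c

/-- The double fundamental quasisymmetric polynomial `𝔉_c(x_n; t) = 𝔓_{F_c}(x_n; t)`. -/
def doubleFundamental {n : ℕ} (c : Fin n → ℕ) : PolyTX := doubleForest (forestOf c)

/-- For `c = (0^{n-ℓ}, a_1, …, a_ℓ)`, the set `{a_1, a_1 + a_2, …, a_1 + ⋯ + a_{ℓ-1}}`. -/
def partialSums {n : ℕ} (c : Fin n → ℕ) : Set ℕ :=
  {s | ∃ k : Fin n, 0 < c k ∧ (k : ℕ) + 1 < n ∧ s = ∑ j ∈ Finset.Iic k, c j}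

open Classical in
/-- The ordinary fundamental quasisymmetric polynomial: the sum of `x_{i_1} ⋯ x_{i_m}` over all
`1 ≤ i_1 ≤ ⋯ ≤ i_m ≤ n` such that `i_j < i_{j+1}` for all `j ∈ Set(c)`, where `m = ∑ c`.
Below `p` and `q` are adjacent positions: they are the positions `j` and `j + 1`, where `j = q`
as positions are counted from `0`. -/
def fundamental {n : ℕ} (c : Fin n → ℕ) : MvPolynomial ℕ ℤ :=
  ∑ i : Fin (∑ k, c k) → Fin n with
      Monotone i ∧ ∀ p q : Fin (∑ k, c k), (p : ℕ) + 1 = q → (q : ℕ) ∈ partialSums c → i p < i q,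
    ∏ j, X (i j : ℕ)

/-- The specialization `f(x; t) ↦ f(x; 0)`. -/
def specializeZero : PolyTX →+* MvPolynomial ℕ ℤ := map (eval (fun _ => 0))

end EQSymPoly

end

open EQSymPoly

/-! Everything rests on a family of coefficient functionals. With matching parameters, the trimmings
satisfy `E_i E_j = E_j E_{i+1}` for `j < i` (`trimOp_comm`), and grafting on codes satisfies the
mirror relation (`graft_comm`). Take a word that builds a code `c`, trim along it while deleting
each used parameter from the alphabet `τ`, and evaluate at what remains: the result `coeffFun τ c`
depends only on `c` (`wordFun_congr`). Trimming lowers the degree and only constants are killed by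
every `E_i`, so these functionals separate polynomials (`eq_zero_of_coeffFun`).

Indexed forests correspond bijectively to finitely supported codes. `QDes` becomes the set of
descents `c_i > 0 = c_{i+1}`, and `F/i` undoes a graft at `i` (`finCode_trim`). The defining
conditions of the family therefore say exactly that `coeffFun tvar e` of the polynomial of `F` is
`1` if `e` is the code of `F` and `0` otherwise, which gives uniqueness. For existence, a dual
family at `τ = 0` is built by induction on the degree, integrating a compatible system of divided
differences (`trimOp_integrate`). By homogeneity the functionals at `τ = t` are unitriangular on it
with respect to degree, so it can be corrected degree by degree (`exists_doubleForestPoly`).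

The algebra of equivariantly quasisymmetric polynomials is the common kernel of all `E_i` with `i +
1 ≠ n` (`mem_eqsym_iff`). A coefficient of such a polynomial vanishes unless the only possible
descent of the code is at `n - 1`, that is, unless the code is padded; the dual family then
restricts to a basis. At `t = 0`, trimming a fundamental polynomial deletes the last letter of its
words, so it has the same coefficients as the specialized double polynomial (`coeffFun_wordSum`). -/

noncomputable section

namespace EQSymPoly

open MvPolynomial

/-! ### Insertion operators and divided differences over a general coefficient domain -/

section Operators

variable {R : Type*} [CommRing R]

/-- Insert the scalar `y` in position `i`: `f(x) ↦ f(x_0, …, x_{i-1}, y, x_i, …)`. -/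
def ins (y : R) (i : ℕ) : MvPolynomial ℕ R →ₐ[R] MvPolynomial ℕ R :=
  aeval fun j => if j < i then X j else if j = i then C y else X (j - 1)

theorem ins_X_of_lt (y : R) {i j : ℕ} (h : j < i) : ins y i (X j) = X j := by
  simp [ins, h]

theorem ins_X_self (y : R) (i : ℕ) : ins y i (X i) = C y := by
  simp [ins]

theorem ins_X_of_gt (y : R) {i j : ℕ} (h : i < j) : ins y i (X j) = X (j - 1) := by
  simp [ins, h.not_gt, h.ne']

theorem ins_C (y : R) (i : ℕ) (a : R) : ins y i (C a) = C a := (ins y i).commutes a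

theorem rMinus_eq (i : ℕ) : rMinus i = ins (tvar i) i := rfl

/-- Both Bergeron–Sottile maps insert the same scalar at adjacent positions, so one operator serves
for both. Keeping the scalar free allows shrinking alphabets and the value `0`. -/
theorem rPlus_eq (i : ℕ) : rPlus i = ins (tvar i) (i + 1) := by
  apply MvPolynomial.algHom_ext
  intro j
  simp [rPlus, ins]

/-- The simplicial identity behind all commutations below: the slot at `b + 1` becomes slot `b` once
the variable at `a ≤ b` has been filled. -/
theorem ins_comp_ins (y z : R) {a b : ℕ} (h : a ≤ b) (f : MvPolynomial ℕ R) :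
    ins y a (ins z (b + 1) f) = ins z b (ins y a f) := by
  have : (ins y a).comp (ins z (b + 1)) = (ins z b).comp (ins y a) := by
    apply MvPolynomial.algHom_ext
    intro k
    simp only [AlgHom.comp_apply]
    rcases lt_trichotomy k a with hk | hk | hk
    · rw [ins_X_of_lt z (by omega), ins_X_of_lt y hk, ins_X_of_lt z (by omega)]
    · subst hk
      rw [ins_X_of_lt z (by omega), ins_X_self, ins_C]
    · rw [ins_X_of_gt y hk]
      rcases lt_trichotomy k (b + 1) with hk' | hk' | hk'
      · rw [ins_X_of_lt z hk', ins_X_of_gt y hk, ins_X_of_lt z (by omega)]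
      · subst hk'
        rw [ins_X_self, ins_C, Nat.add_sub_cancel, ins_X_self]
      · rw [ins_X_of_gt z hk', ins_X_of_gt y (by omega), ins_X_of_gt z (by omega)]
  exact DFunLike.congr_fun this f

theorem ins_of_supported (y : R) {n i : ℕ} (h : n ≤ i) {f : MvPolynomial ℕ R}
    (hf : f ∈ supported R {j : ℕ | j < n}) : ins y i f = f := by
  rw [ins, aeval_def]
  conv_rhs => rw [← eval₂_eta f]
  refine eval₂Hom_congr' rfl ?_ rfl
  intro j hj _
  have := mem_supported.1 hf hj
  simp only [Set.mem_ofPred_eq] at this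
  rw [if_pos (by omega)]

theorem ins_mem_supported (y : R) (n : ℕ) {f : MvPolynomial ℕ R}
    (hf : f ∈ supported R {j : ℕ | j < n + 1}) : ins y n f ∈ supported R {j : ℕ | j < n} := by
  have : (supported R {j : ℕ | j < n + 1}) ≤ (supported R {j : ℕ | j < n}).comap (ins y n) := by
    rw [supported_eq_adjoin_X, Algebra.adjoin_le_iff]
    rintro _ ⟨j, hj, rfl⟩
    simp only [Subalgebra.coe_comap, Set.mem_preimage, SetLike.mem_coe]
    have hj : j < n + 1 := hj
    rcases (Nat.lt_succ_iff.1 hj).lt_or_eq with h | h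
    · rw [ins_X_of_lt y h]
      exact Algebra.subset_adjoin ⟨j, h, rfl⟩
    · subst h
      rw [ins_X_self]
      exact Subalgebra.algebraMap_mem _ y
  exact this hf

theorem exists_mem_supported_lt (f : MvPolynomial ℕ R) :
    ∃ n, f ∈ supported R {j : ℕ | j < n} := by
  obtain ⟨n, hn⟩ := f.vars.bddAbove
  refine ⟨n + 1, mem_supported.2 fun j hj => ?_⟩
  exact Nat.lt_succ_of_le (hn hj)

theorem supported_lt_mono {m n : ℕ} (h : m ≤ n) {f : MvPolynomial ℕ R}
    (hf : f ∈ supported R {j : ℕ | j < m}) : f ∈ supported R {j : ℕ | j < n} :=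
  supported_mono (fun _ hj => lt_of_lt_of_le (show _ < m from hj) h) hf

theorem map_ins {S : Type*} [CommRing S] (σ : R →+* S) (y : R) (i : ℕ) (f : MvPolynomial ℕ R) :
    map σ (ins y i f) = ins (σ y) i (map σ f) := by
  have : (map σ).comp (ins y i : MvPolynomial ℕ R →+* MvPolynomial ℕ R) =
      (ins (σ y) i : MvPolynomial ℕ S →+* MvPolynomial ℕ S).comp (map σ) := by
    apply MvPolynomial.ringHom_ext
    · intro a
      simp [ins]
    · intro j
      simp only [RingHom.comp_apply, RingHom.coe_coe, map_X]
      rcases lt_trichotomy j i with h | h | h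
      · rw [ins_X_of_lt _ h, ins_X_of_lt _ h, map_X]
      · subst h
        rw [ins_X_self, ins_X_self, map_C]
      · rw [ins_X_of_gt _ h, ins_X_of_gt _ h, map_X]
  exact DFunLike.congr_fun this f

theorem totalDegree_ins_le (y : R) (i : ℕ) (f : MvPolynomial ℕ R) :
    (ins y i f).totalDegree ≤ f.totalDegree := by
  rw [ins, aeval_def, eval₂_eq]
  refine totalDegree_finsetSum_le fun d hd => ?_
  refine (totalDegree_mul _ _).trans ?_
  rw [algebraMap_eq, totalDegree_C, zero_add]
  refine (totalDegree_finsetProd _ _).trans ?_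
  refine le_trans (Finset.sum_le_sum fun j _ => ?_) (le_totalDegree hd)
  refine (totalDegree_pow _ _).trans ?_
  have : (if j < i then X j else if j = i then C y else X (j - 1) :
      MvPolynomial ℕ R).totalDegree ≤ 1 := by
    rcases subsingleton_or_nontrivial R with h | h
    · rw [Subsingleton.elim (if j < i then X j else if j = i then C y else X (j - 1) :
        MvPolynomial ℕ R) 0, totalDegree_zero]
      omega
    · split_ifs <;> simp
  simpa using Nat.mul_le_mul_left (d j) this

/-- Modulo `X i - C y` the variable `X i` equals `y`, and putting `y` just before or just after it
makes no difference. -/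
theorem X_sub_C_dvd (y : R) (i : ℕ) (f : MvPolynomial ℕ R) :
    X i - C y ∣ ins y (i + 1) f - ins y i f := by
  rw [← Ideal.mem_span_singleton, ← Ideal.Quotient.mk_eq_mk_iff_sub_mem]
  set I : Ideal (MvPolynomial ℕ R) := Ideal.span {X i - C y}
  have hx : Ideal.Quotient.mk I (X i) = Ideal.Quotient.mk I (C y) := by
    rw [Ideal.Quotient.mk_eq_mk_iff_sub_mem, Ideal.mem_span_singleton]
  have h : (Ideal.Quotient.mkₐ R I).comp (ins y (i + 1)) =
      (Ideal.Quotient.mkₐ R I).comp (ins y i) := by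
    apply MvPolynomial.algHom_ext
    intro j
    simp only [AlgHom.comp_apply, Ideal.Quotient.mkₐ_eq_mk]
    rcases lt_trichotomy j i with hj | hj | hj
    · rw [ins_X_of_lt _ hj, ins_X_of_lt _ (by omega)]
    · subst hj
      rw [ins_X_of_lt _ (by omega), ins_X_self, hx]
    · rw [ins_X_of_gt _ hj]
      rcases (Nat.succ_le_of_lt hj).eq_or_lt with h1 | h1
      · rw [← h1, ins_X_self, Nat.succ_sub_one, hx]
      · rw [ins_X_of_gt _ h1]
  exact DFunLike.congr_fun h f

theorem coeff_single_X_sub_C (y : R) (i : ℕ) :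
    coeff (Finsupp.single i 1) (X i - C y : MvPolynomial ℕ R) = 1 := by
  have h : (0 : ℕ →₀ ℕ) ≠ Finsupp.single i 1 :=
    fun h => one_ne_zero (Finsupp.single_eq_zero.1 h.symm)
  simp [coeff_C, h]

theorem X_sub_C_ne_zero [Nontrivial R] (y : R) (i : ℕ) : (X i - C y : MvPolynomial ℕ R) ≠ 0 := by
  intro h
  have := congrArg (coeff (Finsupp.single i 1)) h
  rw [coeff_single_X_sub_C, coeff_zero] at this
  exact one_ne_zero this

variable [IsDomain R]

/-- The divided difference `f ↦ (R_{i+1} f - R_i f) / (x_i - y)`, where `R_i` inserts `y` in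
position `i`. -/
def trimOp (y : R) (i : ℕ) : MvPolynomial ℕ R →ₗ[R] MvPolynomial ℕ R where
  toFun f := Classical.choose (X_sub_C_dvd y i f)
  map_add' f g := by
    apply mul_left_cancel₀ (X_sub_C_ne_zero y i)
    rw [mul_add, ← Classical.choose_spec (X_sub_C_dvd y i f),
      ← Classical.choose_spec (X_sub_C_dvd y i g),
      ← Classical.choose_spec (X_sub_C_dvd y i (f + g)), map_add, map_add]
    ring
  map_smul' a f := by
    apply mul_left_cancel₀ (X_sub_C_ne_zero y i)
    rw [RingHom.id_apply, mul_smul_comm, ← Classical.choose_spec (X_sub_C_dvd y i f),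
      ← Classical.choose_spec (X_sub_C_dvd y i (a • f)), map_smul, map_smul, smul_sub]

theorem trimOp_spec (y : R) (i : ℕ) (f : MvPolynomial ℕ R) :
    (X i - C y) * trimOp y i f = ins y (i + 1) f - ins y i f :=
  (Classical.choose_spec (X_sub_C_dvd y i f)).symm

theorem trimOp_eq_of_mul_eq {y : R} {i : ℕ} {f g : MvPolynomial ℕ R}
    (h : (X i - C y) * g = ins y (i + 1) f - ins y i f) : trimOp y i f = g :=
  mul_left_cancel₀ (X_sub_C_ne_zero y i) ((trimOp_spec y i f).trans h.symm)

theorem trimOp_eq_zero_iff (y : R) (i : ℕ) (f : MvPolynomial ℕ R) :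
    trimOp y i f = 0 ↔ ins y (i + 1) f = ins y i f := by
  constructor
  · intro h
    have := trimOp_spec y i f
    rw [h, mul_zero] at this
    exact (sub_eq_zero.1 this.symm)
  · intro h
    exact trimOp_eq_of_mul_eq (by rw [h, mul_zero, sub_self])

theorem eope_eq_trimOp (i : ℕ) (f : PolyTX) : eope i f = trimOp (tvar i) i f :=
  (trimOp_eq_of_mul_eq (by rw [eope_spec, rPlus_eq, rMinus_eq])).symm

/-- Trimming at `j` removes a variable, so position `i + 1` becomes `i`. After clearing both
denominators, each side is a signed sum of four double insertions, matched by `ins_comp_ins`. -/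
theorem trimOp_comm (y z : R) {i j : ℕ} (h : j < i) (f : MvPolynomial ℕ R) :
    trimOp z i (trimOp y j f) = trimOp y j (trimOp z (i + 1) f) := by
  apply mul_left_cancel₀ (X_sub_C_ne_zero z i)
  apply mul_left_cancel₀ (X_sub_C_ne_zero y j)
  have h1 := congrArg (ins z (i + 1)) (trimOp_spec y j f)
  have h2 := congrArg (ins z i) (trimOp_spec y j f)
  have h3 := congrArg (ins y (j + 1)) (trimOp_spec z (i + 1) f)
  have h4 := congrArg (ins y j) (trimOp_spec z (i + 1) f)
  have h5 := trimOp_spec z i (trimOp y j f)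
  have h6 := trimOp_spec y j (trimOp z (i + 1) f)
  simp only [map_mul, map_sub, ins_C] at h1 h2 h3 h4
  rw [ins_X_of_lt z (by omega)] at h1 h2
  rw [ins_X_of_gt y (by omega), Nat.add_sub_cancel] at h3 h4
  rw [← ins_comp_ins y z (a := j + 1) (b := i + 1) (by omega),
    ← ins_comp_ins y z (a := j) (b := i + 1) (by omega)] at h1
  rw [← ins_comp_ins y z (a := j + 1) (b := i) (by omega),
    ← ins_comp_ins y z (a := j) (b := i) (by omega)] at h2
  linear_combination (X j - C y) * h5 + h1 - h2 - (X i - C z) * h6 - h3 + h4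

theorem map_trimOp {S : Type*} [CommRing S] [IsDomain S] (σ : R →+* S) (y : R) (i : ℕ)
    (f : MvPolynomial ℕ R) : map σ (trimOp y i f) = trimOp (σ y) i (map σ f) := by
  symm
  apply trimOp_eq_of_mul_eq
  have := congrArg (map σ) (trimOp_spec y i f)
  simpa [map_ins] using this

theorem trimOp_C (y : R) (i : ℕ) (a : R) : trimOp y i (C a) = 0 := by
  rw [trimOp_eq_zero_iff, ins_C, ins_C]

/-- Insertion does not raise the degree, and the quotient is by a polynomial of degree at least one.
-/
theorem totalDegree_trimOp_lt (y : R) (i : ℕ) (f : MvPolynomial ℕ R) (h : trimOp y i f ≠ 0) :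
    (trimOp y i f).totalDegree < f.totalDegree := by
  have h1 := congrArg totalDegree (trimOp_spec y i f)
  rw [totalDegree_mul_of_isDomain (X_sub_C_ne_zero y i) h] at h1
  have h2 : 1 ≤ (X i - C y : MvPolynomial ℕ R).totalDegree := by
    have : Finsupp.single i 1 ∈ (X i - C y : MvPolynomial ℕ R).support := by
      rw [mem_support_iff, coeff_single_X_sub_C]
      exact one_ne_zero
    simpa using le_totalDegree this
  have h3 := totalDegree_sub (ins y (i + 1) f) (ins y i f)
  have h4 := totalDegree_ins_le y i f
  have h5 := totalDegree_ins_le y (i + 1) f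
  have := max_le h5 h4
  omega

theorem trimOp_of_supported (y : R) {n i : ℕ} (h : n ≤ i) {f : MvPolynomial ℕ R}
    (hf : f ∈ supported R {j : ℕ | j < n}) : trimOp y i f = 0 := by
  rw [trimOp_eq_zero_iff, ins_of_supported y h hf, ins_of_supported y (by omega) hf]

/-- Variables are peeled off from the top: if `n + k` is the largest index allowed, insertion at `n
+ k + 1` fixes `f`, while insertion at `n + k` eliminates the variable `X (n + k)`. -/
theorem mem_supported_of_trimOp (τ : ℕ → R) (n : ℕ) {f : MvPolynomial ℕ R}
    (hf : ∀ i, n ≤ i → trimOp (τ i) i f = 0) : f ∈ supported R {j : ℕ | j < n} := by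
  obtain ⟨N, hN⟩ := exists_mem_supported_lt f
  have key : ∀ k, f ∈ supported R {j : ℕ | j < n + k} → f ∈ supported R {j : ℕ | j < n} := by
    intro k
    induction k with
    | zero => exact id
    | succ k ih =>
      intro h
      apply ih
      have h1 := (trimOp_eq_zero_iff _ _ _).1 (hf (n + k) (by omega))
      rw [ins_of_supported _ (by omega) h] at h1
      rw [h1]
      exact ins_mem_supported _ _ h
  exact key N (supported_lt_mono (by omega) hN)

theorem eq_C_of_trimOp_eq_zero (τ : ℕ → R) {f : MvPolynomial ℕ R}
    (hf : ∀ i, trimOp (τ i) i f = 0) : f = C (aeval τ f) := by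
  have h := mem_supported_of_trimOp τ 0 (f := f) fun i _ => hf i
  have : {j : ℕ | j < 0} = ∅ := by ext; simp
  rw [this, supported_empty] at h
  obtain ⟨a, rfl⟩ := Algebra.mem_bot.1 h
  simp [algebraMap_eq]

theorem trimOp_X_mul_of_lt (y : R) {i j : ℕ} (h : i < j) (g : MvPolynomial ℕ R) :
    trimOp y j (X i * g) = X i * trimOp y j g := by
  apply trimOp_eq_of_mul_eq
  rw [map_mul, map_mul, ins_X_of_lt _ h, ins_X_of_lt _ (by omega)]
  linear_combination X i * trimOp_spec y j g

end Operators

/-! ### Grafting on codes -/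

/-- The increasing map `ℕ → ℕ` that omits the value `i`. -/
def skip (i j : ℕ) : ℕ := if j < i then j else j + 1

theorem skip_injective (i : ℕ) : Function.Injective (skip i) := by
  intro a b h
  unfold skip at h
  split_ifs at h <;> omega

/-- The relation of `trimOp_comm` for the alphabets that remain after two deletions. -/
theorem skip_comp_skip {i j : ℕ} (h : j < i) : skip j ∘ skip i = skip (i + 1) ∘ skip j := by
  funext k
  simp only [Function.comp_apply, skip]
  split_ifs <;> omega

/-- Insert a zero after position `i` of a code, and increase the entry in position `i`. -/
def graft (c : ℕ →₀ ℕ) (i : ℕ) : ℕ →₀ ℕ :=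
  Finsupp.embDomain ⟨skip (i + 1), skip_injective (i + 1)⟩ c + Finsupp.single i 1

/-- Delete the entry after position `i` of a code, and decrease the entry in position `i`. -/
def prune (c : ℕ →₀ ℕ) (i : ℕ) : ℕ →₀ ℕ :=
  Finsupp.comapDomain (skip (i + 1)) c (skip_injective (i + 1)).injOn - Finsupp.single i 1

theorem graft_apply (c : ℕ →₀ ℕ) (i j : ℕ) :
    graft c i j = if j < i then c j else if j = i then c i + 1 else
      if j = i + 1 then 0 else c (j - 1) := by
  have key : ∀ k, Finsupp.embDomain ⟨skip (i + 1), skip_injective (i + 1)⟩ c (skip (i + 1) k) =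
      c k := fun k => Finsupp.embDomain_apply_self ⟨skip (i + 1), skip_injective (i + 1)⟩ c k
  rw [graft, Finsupp.add_apply]
  rcases lt_trichotomy j i with h | h | h
  · have := key j
    rw [skip, if_pos (by omega)] at this
    rw [this, if_pos h, Finsupp.single_eq_of_ne (by omega), add_zero]
  · subst h
    have := key j
    rw [skip, if_pos (by omega)] at this
    simp [this]
  · rw [if_neg (by omega), if_neg (by omega), Finsupp.single_eq_of_ne (by omega), add_zero]
    split_ifs with h1
    · apply Finsupp.embDomain_of_notMem_range
      rintro ⟨k, hk⟩
      simp only [Function.Embedding.coeFn_mk, skip] at hk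
      split_ifs at hk <;> omega
    · have := key (j - 1)
      rwa [skip, if_neg (by omega), Nat.sub_add_cancel (by omega)] at this

theorem prune_apply (c : ℕ →₀ ℕ) (i j : ℕ) :
    prune c i j = if j < i then c j else if j = i then c i - 1 else c (j + 1) := by
  rw [prune, Finsupp.tsub_apply, Finsupp.comapDomain_apply, skip]
  rcases lt_trichotomy j i with h | h | h
  · rw [if_pos (by omega), if_pos h, Finsupp.single_eq_of_ne (by omega), Nat.sub_zero]
  · subst h
    simp
  · rw [if_neg (by omega), if_neg (by omega), if_neg (by omega),
      Finsupp.single_eq_of_ne (by omega), Nat.sub_zero]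

theorem graft_self (c : ℕ →₀ ℕ) (i : ℕ) : graft c i i = c i + 1 := by simp [graft_apply]

theorem graft_succ (c : ℕ →₀ ℕ) (i : ℕ) : graft c i (i + 1) = 0 := by simp [graft_apply]

theorem prune_graft (c : ℕ →₀ ℕ) (i : ℕ) : prune (graft c i) i = c := by
  ext j
  simp only [prune_apply, graft_apply]
  split_ifs <;> first | omega | (subst_vars; omega) | congr 1

theorem graft_prune {c : ℕ →₀ ℕ} {i : ℕ} (h : 0 < c i) (h' : c (i + 1) = 0) :
    graft (prune c i) i = c := by
  ext j
  simp only [prune_apply, graft_apply]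
  split_ifs <;> first | omega | (subst_vars; omega) | (congr 1; omega)

theorem graft_injective (i : ℕ) : Function.Injective fun c => graft c i := fun a b h => by
  have := congrArg (fun c => prune c i) h
  simpa only [prune_graft] using this

theorem exists_graft_iff {c : ℕ →₀ ℕ} {i : ℕ} :
    (∃ e, c = graft e i) ↔ 0 < c i ∧ c (i + 1) = 0 := by
  constructor
  · rintro ⟨e, rfl⟩
    rw [graft_self, graft_succ]
    exact ⟨Nat.succ_pos _, rfl⟩
  · rintro ⟨h, h'⟩
    exact ⟨_, (graft_prune h h').symm⟩

/-- The relation dual to `trimOp_comm`, so that grafting mirrors iterated trimming. -/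
theorem graft_comm (c : ℕ →₀ ℕ) {i j : ℕ} (h : j < i) :
    graft (graft c i) j = graft (graft c j) (i + 1) := by
  ext k
  simp only [graft_apply]
  split_ifs <;> first | omega | (subst_vars; omega) | congr 1

/-- A graft at `i` leaves a zero at `i + 1`, which excludes `j = i + 1`; the two grafts are then far
enough apart to be undone independently. This is the local confluence used in `wordFun_congr`. -/
theorem graft_confluent {u v : ℕ →₀ ℕ} {i j : ℕ} (hij : i < j) (h : graft u i = graft v j) :
    ∃ k d, j = k + 1 ∧ i < k ∧ u = graft d k ∧ v = graft d i := by
  have hj : 0 < graft u i j := by rw [h, graft_self]; exact Nat.succ_pos _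
  have hj' : graft u i (j + 1) = 0 := by rw [h, graft_succ]
  have hne : j ≠ i + 1 := by
    rintro rfl
    rw [graft_succ] at hj
    exact lt_irrefl _ hj
  obtain ⟨k, rfl⟩ : ∃ k, j = k + 1 := ⟨j - 1, by omega⟩
  have hk : i < k := by omega
  rw [graft_apply, if_neg (by omega), if_neg (by omega), if_neg (by omega)] at hj hj'
  simp only [Nat.add_sub_cancel] at hj hj'
  refine ⟨k, prune u k, rfl, hk, (graft_prune hj hj').symm, ?_⟩
  apply graft_injective (k + 1)
  change graft v (k + 1) = graft (graft (prune u k) i) (k + 1)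
  rw [← graft_comm _ hk, graft_prune hj hj', h]

theorem degree_graft (c : ℕ →₀ ℕ) (i : ℕ) : (graft c i).degree = c.degree + 1 := by
  rw [graft, map_add, Finsupp.degree_single]
  congr 1
  rw [Finsupp.degree_apply, Finsupp.degree_apply, Finsupp.support_embDomain, Finset.sum_map]
  exact Finset.sum_congr rfl fun k _ => Finsupp.embDomain_apply_self _ c k

/-- The last nonzero entry is followed by a zero, so it can be pruned. -/
theorem exists_graft_of_ne_zero {c : ℕ →₀ ℕ} {k : ℕ} (h : c k ≠ 0) :
    ∃ i e, k ≤ i ∧ c = graft e i := by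
  have hne : c.support.Nonempty := ⟨k, Finsupp.mem_support_iff.2 h⟩
  obtain ⟨e, he⟩ := (exists_graft_iff (c := c) (i := c.support.max' hne)).2
    ⟨Nat.pos_of_ne_zero (Finsupp.mem_support_iff.1 (c.support.max'_mem hne)), by
      by_contra hc
      have := c.support.le_max' _ (Finsupp.mem_support_iff.2 hc)
      omega⟩
  exact ⟨_, e, c.support.le_max' _ (Finsupp.mem_support_iff.2 h), he⟩

theorem eq_zero_or_exists_graft (c : ℕ →₀ ℕ) : c = 0 ∨ ∃ i e, c = graft e i := by
  by_cases h : c = 0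
  · exact Or.inl h
  · obtain ⟨k, hk⟩ := Finsupp.ne_iff.1 h
    obtain ⟨i, e, -, he⟩ := exists_graft_of_ne_zero hk
    exact Or.inr ⟨i, e, he⟩

theorem graft_ne_zero (c : ℕ →₀ ℕ) (i : ℕ) : graft c i ≠ 0 := by
  intro h
  have := congrArg Finsupp.degree h
  rw [degree_graft] at this
  simp at this

/-- Induction on codes by grafting. -/
theorem graft_induction {p : (ℕ →₀ ℕ) → Prop} (h0 : p 0) (h : ∀ c i, p c → p (graft c i))
    (c : ℕ →₀ ℕ) : p c := by
  induction hd : c.degree generalizing c with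
  | zero => rwa [(Finsupp.degree_eq_zero_iff c).1 hd]
  | succ d ih =>
    rcases eq_zero_or_exists_graft c with rfl | ⟨i, e, rfl⟩
    · exact h0
    · rw [degree_graft] at hd
      exact h e i (ih e (by omega))

/-- The code obtained from `0` by grafting at the letters of a word, the last letter first. -/
def wordCode : List ℕ → (ℕ →₀ ℕ)
  | [] => 0
  | i :: w => graft (wordCode w) i

theorem degree_wordCode (w : List ℕ) : (wordCode w).degree = w.length := by
  induction w with
  | nil => simp [wordCode]
  | cons i w ih => rw [wordCode, degree_graft, ih, List.length_cons]

theorem wordCode_surjective : Function.Surjective wordCode :=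
  graft_induction ⟨[], rfl⟩ fun _ i ⟨w, hw⟩ => ⟨i :: w, by rw [wordCode, hw]⟩

/-! ### The coefficient functionals -/

section Functionals

variable {R : Type*} [CommRing R] [IsDomain R]

/-- Iterated trimming along a word, followed by the evaluation at the remaining alphabet. -/
def wordFun : (ℕ → R) → List ℕ → (MvPolynomial ℕ R →ₗ[R] R)
  | τ, [] => (aeval τ).toLinearMap
  | τ, i :: w => wordFun (τ ∘ skip i) w ∘ₗ trimOp (τ i) i

theorem wordFun_cons (τ : ℕ → R) (i : ℕ) (w : List ℕ) :
    wordFun τ (i :: w) = wordFun (τ ∘ skip i) w ∘ₗ trimOp (τ i) i := rfl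

theorem wordFun_swap (τ : ℕ → R) {i j : ℕ} (h : j < i) (w : List ℕ) :
    wordFun τ (j :: i :: w) = wordFun τ ((i + 1) :: j :: w) := by
  refine LinearMap.ext fun f => ?_
  have h1 : skip j i = i + 1 := if_neg (by omega)
  have h2 : skip (i + 1) j = j := if_pos (by omega)
  simp only [wordFun, LinearMap.comp_apply, Function.comp_apply, h1, h2]
  rw [trimOp_comm _ _ h, Function.comp_assoc, Function.comp_assoc, skip_comp_skip h]

/-- A diamond argument by induction on the length. If the first letters are `i < j`, confluence
provides a common ancestor `d`; spelling it as a word `z`, the tails may be replaced by `k :: z` and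
`i :: z`, and the two words then differ by one swap. -/
theorem wordFun_congr {w w' : List ℕ} (h : wordCode w = wordCode w') (τ : ℕ → R) :
    wordFun τ w = wordFun τ w' := by
  induction hn : w.length generalizing w w' τ with
  | zero =>
    have h' := congrArg Finsupp.degree h
    rw [degree_wordCode, degree_wordCode, hn] at h'
    rw [List.length_eq_zero_iff.1 hn, List.length_eq_zero_iff.1 h'.symm]
  | succ n ih =>
    have key : ∀ (i j : ℕ) (u v : List ℕ), i < j → u.length = n → v.length = n →
        graft (wordCode u) i = graft (wordCode v) j →
        wordFun τ (i :: u) = wordFun τ (j :: v) := by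
      intro i j u v hij hu hv he
      obtain ⟨k, d, rfl, hk, h1, h2⟩ := graft_confluent hij he
      obtain ⟨z, rfl⟩ := wordCode_surjective d
      have e1 := fun τ' : ℕ → R => ih (w := u) (w' := k :: z) h1 τ' hu
      have e2 := fun τ' : ℕ → R => ih (w := v) (w' := i :: z) h2 τ' hv
      calc wordFun τ (i :: u) = wordFun τ (i :: k :: z) := by
            rw [wordFun_cons, e1, ← wordFun_cons]
        _ = wordFun τ ((k + 1) :: i :: z) := wordFun_swap τ hk z
        _ = wordFun τ ((k + 1) :: v) := by
            rw [wordFun_cons τ (k + 1) v, e2, ← wordFun_cons]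
    have hn' : w'.length = n + 1 := by
      rw [← degree_wordCode, ← h, degree_wordCode, hn]
    cases w with
    | nil => simp at hn
    | cons i u =>
      cases w' with
      | nil => simp at hn'
      | cons j v =>
        rw [List.length_cons, Nat.succ_inj] at hn hn'
        rcases lt_trichotomy i j with hij | rfl | hij
        · exact key i j u v hij hn hn' h
        · rw [wordFun_cons, wordFun_cons, ih (graft_injective i h) _ hn]
        · exact (key j i v u hij hn' hn h.symm).symm

/-- The coefficient functional of a code. -/
def coeffFun (τ : ℕ → R) (c : ℕ →₀ ℕ) : MvPolynomial ℕ R →ₗ[R] R :=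
  wordFun τ (Function.surjInv wordCode_surjective c)

theorem coeffFun_wordCode (τ : ℕ → R) (w : List ℕ) : coeffFun τ (wordCode w) = wordFun τ w :=
  wordFun_congr (Function.surjInv_eq wordCode_surjective _) τ

theorem coeffFun_zero (τ : ℕ → R) (f : MvPolynomial ℕ R) : coeffFun τ 0 f = aeval τ f := by
  change coeffFun τ (wordCode []) f = _
  rw [coeffFun_wordCode]
  rfl

theorem coeffFun_graft (τ : ℕ → R) (c : ℕ →₀ ℕ) (i : ℕ) (f : MvPolynomial ℕ R) :
    coeffFun τ (graft c i) f = coeffFun (τ ∘ skip i) c (trimOp (τ i) i f) := by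
  obtain ⟨w, rfl⟩ := wordCode_surjective c
  change coeffFun τ (wordCode (i :: w)) f = _
  rw [coeffFun_wordCode, coeffFun_wordCode]
  rfl

/-- Base change serves two purposes: the specialization `t = 0`, and the renaming of `t` in the
recursion for `F/i`. -/
theorem map_coeffFun {S : Type*} [CommRing S] [IsDomain S] (σ : R →+* S) (τ : ℕ → R)
    (c : ℕ →₀ ℕ) (f : MvPolynomial ℕ R) :
    σ (coeffFun τ c f) = coeffFun (fun i => σ (τ i)) c (map σ f) := by
  induction c using graft_induction generalizing τ f with
  | h0 =>
    rw [coeffFun_zero, coeffFun_zero, aeval_def, aeval_def, eval₂_map, ← coe_eval₂Hom,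
      ← coe_eval₂Hom]
    rw [map_eval₂Hom]
    simp
  | h c i ih =>
    rw [coeffFun_graft, coeffFun_graft, ih, map_trimOp]
    rfl

theorem coeffFun_eq_zero_of_degree_lt (τ : ℕ → R) {c : ℕ →₀ ℕ} {f : MvPolynomial ℕ R}
    (h : f.totalDegree < c.degree) : coeffFun τ c f = 0 := by
  induction c using graft_induction generalizing τ f with
  | h0 => simp at h
  | h c i ih =>
    rw [coeffFun_graft]
    by_cases h0 : trimOp (τ i) i f = 0
    · rw [h0, map_zero]
    · apply ih
      have := totalDegree_trimOp_lt _ _ _ h0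
      rw [degree_graft] at h
      omega

/-- The code is a graft at some `i ≥ n`, and `E_i` kills polynomials in the first `n` variables. -/
theorem coeffFun_eq_zero_of_supported (τ : ℕ → R) {c : ℕ →₀ ℕ} {f : MvPolynomial ℕ R} {n k : ℕ}
    (hf : f ∈ supported R {j : ℕ | j < n}) (hk : n ≤ k) (hc : c k ≠ 0) : coeffFun τ c f = 0 := by
  obtain ⟨i, e, hi, rfl⟩ := exists_graft_of_ne_zero hc
  rw [coeffFun_graft, trimOp_of_supported _ (hk.trans hi) hf, map_zero]

theorem finite_coeffFun_ne_zero (τ : ℕ → R) (f : MvPolynomial ℕ R) :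
    {c | coeffFun τ c f ≠ 0}.Finite := by
  obtain ⟨n, hn⟩ := exists_mem_supported_lt f
  refine ((Finset.range (f.totalDegree + 1)).biUnion fun d =>
    Finset.finsuppAntidiag (Finset.range n) d).finite_toSet.subset fun c hc => ?_
  have h1 : c.degree ≤ f.totalDegree := by
    by_contra h
    exact hc (coeffFun_eq_zero_of_degree_lt τ (not_le.1 h))
  have h2 : c.support ⊆ Finset.range n := by
    intro k hk
    by_contra h
    exact hc (coeffFun_eq_zero_of_supported τ hn (not_lt.1 (by simpa using h))
      (Finsupp.mem_support_iff.1 hk))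
  simp only [Finset.coe_biUnion, Set.mem_iUnion, Finset.mem_coe, Finset.mem_range,
    Finset.mem_finsuppAntidiag]
  refine ⟨c.degree, by omega, ?_, h2⟩
  rw [Finsupp.degree_apply]
  exact (Finset.sum_subset h2 fun k _ hk => Finsupp.notMem_support_iff.1 hk).symm

/-- The coefficients of `E_i f` for the alphabet without `τ i` are coefficients of `f`, so by
induction on the degree every `E_i f` vanishes. Then `f` is a constant, equal to its coefficient at
the code `0`. The alphabet must vary in the induction. -/
theorem eq_zero_of_coeffFun (τ : ℕ → R) {f : MvPolynomial ℕ R} (h : ∀ c, coeffFun τ c f = 0) :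
    f = 0 := by
  induction hd : f.totalDegree using Nat.strong_induction_on generalizing τ f with
  | _ d ih =>
    have hT : ∀ i, trimOp (τ i) i f = 0 := by
      intro i
      by_contra h0
      exact h0 (ih _ (hd ▸ totalDegree_trimOp_lt _ _ _ h0) (τ ∘ skip i)
        (fun c => by rw [← coeffFun_graft, h]) rfl)
    rw [eq_C_of_trimOp_eq_zero τ hT, ← coeffFun_zero, h, C_0]

theorem eq_of_coeffFun (τ : ℕ → R) {f g : MvPolynomial ℕ R}
    (h : ∀ c, coeffFun τ c f = coeffFun τ c g) : f = g :=
  sub_eq_zero.1 (eq_zero_of_coeffFun τ fun c => by rw [map_sub, h, sub_self])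

end Functionals

/-! ### Homogeneity in all variables together -/

/-- Homogeneity of degree `d` in the variables `x` and `t` together. -/
def HomogTX (d : ℕ) (f : PolyTX) : Prop :=
  ((sumAlgEquiv ℤ ℕ ℕ).symm f).IsHomogeneous d

theorem HomogTX.zero (d : ℕ) : HomogTX d 0 := by
  unfold HomogTX
  rw [map_zero]
  exact isHomogeneous_zero _ _ _

theorem HomogTX.sub {d : ℕ} {f g : PolyTX} (hf : HomogTX d f) (hg : HomogTX d g) :
    HomogTX d (f - g) := by
  unfold HomogTX at *
  rw [map_sub]
  exact hf.sub hg

theorem HomogTX.mul {d e : ℕ} {f g : PolyTX} (hf : HomogTX d f) (hg : HomogTX e g) :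
    HomogTX (d + e) (f * g) := by
  unfold HomogTX at *
  rw [map_mul]
  exact IsHomogeneous.mul hf hg

theorem HomogTX.sum {ι : Type*} (s : Finset ι) {d : ℕ} {f : ι → PolyTX}
    (hf : ∀ i ∈ s, HomogTX d (f i)) : HomogTX d (∑ i ∈ s, f i) := by
  unfold HomogTX at *
  rw [map_sum]
  exact IsHomogeneous.sum _ _ _ hf

theorem homogTX_X (i : ℕ) : HomogTX 1 (X i) := by
  unfold HomogTX
  rw [sumAlgEquiv_symm_X]
  exact isHomogeneous_X _ _

theorem sumAlgEquiv_symm_C (a : CoeffT) :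
    (sumAlgEquiv ℤ ℕ ℕ).symm (C a) = rename Sum.inr a := by
  rw [AlgEquiv.symm_apply_eq]
  have : (IsScalarTower.toAlgHom ℤ CoeffT PolyTX) =
      (sumAlgEquiv ℤ ℕ ℕ).toAlgHom.comp (rename Sum.inr) := by
    apply MvPolynomial.algHom_ext
    intro j
    simp [sumAlgEquiv_X_inr, algebraMap_eq]
  exact DFunLike.congr_fun this a

theorem homogTX_C {d : ℕ} {a : CoeffT} (ha : a.IsHomogeneous d) : HomogTX d (C a) := by
  unfold HomogTX
  rw [sumAlgEquiv_symm_C]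
  exact ha.rename_isHomogeneous

/-- In the ring of all variables together, insertion is a substitution by linear forms when `y` is
linear; this makes `IsHomogeneous.aeval` applicable. -/
theorem sumAlgEquiv_symm_ins (y : CoeffT) (i : ℕ) (f : PolyTX) :
    (sumAlgEquiv ℤ ℕ ℕ).symm (ins y i f) =
      aeval (Sum.elim (fun j => (sumAlgEquiv ℤ ℕ ℕ).symm (ins y i (X j))) fun j => X (Sum.inr j))
        ((sumAlgEquiv ℤ ℕ ℕ).symm f) := by
  obtain ⟨s, rfl⟩ := (sumAlgEquiv ℤ ℕ ℕ).surjective f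
  rw [AlgEquiv.symm_apply_apply]
  have : ((sumAlgEquiv ℤ ℕ ℕ).symm.toAlgHom.comp ((ins y i).restrictScalars ℤ)).comp
      (sumAlgEquiv ℤ ℕ ℕ).toAlgHom =
      aeval (Sum.elim (fun j => (sumAlgEquiv ℤ ℕ ℕ).symm (ins y i (X j)))
        fun j => X (Sum.inr j)) := by
    apply MvPolynomial.algHom_ext
    rintro (j | j)
    · simp [sumAlgEquiv_X_inl]
    · simp [sumAlgEquiv_X_inr]
  exact DFunLike.congr_fun this s

theorem HomogTX.ins {y : CoeffT} (hy : y.IsHomogeneous 1) (i : ℕ) {d : ℕ} {f : PolyTX}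
    (hf : HomogTX d f) : HomogTX d (ins y i f) := by
  unfold HomogTX at *
  rw [sumAlgEquiv_symm_ins]
  have := hf.aeval (S := ℤ)
    (Sum.elim (fun j => (sumAlgEquiv ℤ ℕ ℕ).symm (EQSymPoly.ins y i (X j)))
      fun j => X (Sum.inr j)) (n := 1) ?_
  · rwa [one_mul] at this
  · rintro (j | j)
    · change HomogTX 1 (EQSymPoly.ins y i (X j))
      rcases lt_trichotomy j i with h | h | h
      · rw [ins_X_of_lt _ h]
        exact homogTX_X _
      · subst h
        rw [ins_X_self]
        exact homogTX_C hy
      · rw [ins_X_of_gt _ h]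
        exact homogTX_X _
    · exact isHomogeneous_X _ _

theorem HomogTX.aeval {τ : ℕ → CoeffT} (hτ : ∀ i, (τ i).IsHomogeneous 1) {d : ℕ} {f : PolyTX}
    (hf : HomogTX d f) : (aeval τ f).IsHomogeneous d := by
  have key : MvPolynomial.aeval τ f =
      MvPolynomial.aeval (Sum.elim τ X) ((sumAlgEquiv ℤ ℕ ℕ).symm f) := by
    obtain ⟨s, rfl⟩ := (sumAlgEquiv ℤ ℕ ℕ).surjective f
    rw [AlgEquiv.symm_apply_apply]
    have : ((MvPolynomial.aeval τ).restrictScalars ℤ).comp (sumAlgEquiv ℤ ℕ ℕ).toAlgHom =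
        MvPolynomial.aeval (Sum.elim τ X) := by
      apply MvPolynomial.algHom_ext
      rintro (j | j)
      · simp [sumAlgEquiv_X_inl]
      · simp [sumAlgEquiv_X_inr]
    exact DFunLike.congr_fun this s
  rw [key]
  have := IsHomogeneous.aeval (S := ℤ) hf (Sum.elim τ X) (n := 1) ?_
  · rwa [one_mul] at this
  · rintro (j | j)
    · exact hτ j
    · exact isHomogeneous_X _ _

/-! ### Exact division by a linear form and homogeneity -/

section Division

variable {σ : Type*} {R : Type*} [CommRing R]

theorem homogeneousComponent_succ_mul {a : MvPolynomial σ R} (ha : a.IsHomogeneous 1)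
    (g : MvPolynomial σ R) (k : ℕ) :
    homogeneousComponent (k + 1) (a * g) = a * homogeneousComponent k g := by
  conv_lhs => rw [← sum_homogeneousComponent g, Finset.mul_sum, map_sum]
  have h : ∀ j, homogeneousComponent (k + 1) (a * homogeneousComponent j g) =
      if j = k then a * homogeneousComponent k g else 0 := by
    intro j
    have hm : a * homogeneousComponent j g ∈ homogeneousSubmodule σ R (j + 1) := by
      rw [mem_homogeneousSubmodule, add_comm]
      exact ha.mul (homogeneousComponent_isHomogeneous _ _)
    rw [homogeneousComponent_of_mem hm]
    by_cases hj : j = k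
    · subst hj
      simp
    · rw [if_neg hj, if_neg (by omega)]
  rw [Finset.sum_congr rfl fun j _ => h j, Finset.sum_ite_eq']
  split_ifs with hk
  · rfl
  · rw [homogeneousComponent_eq_zero, mul_zero]
    simpa using hk

variable [IsDomain R]

theorem isHomogeneous_of_mul {a g : MvPolynomial σ R} (ha : a.IsHomogeneous 1) (ha0 : a ≠ 0)
    {d : ℕ} (h : (a * g).IsHomogeneous (d + 1)) : g.IsHomogeneous d := by
  have hk : ∀ k, k ≠ d → homogeneousComponent k g = 0 := by
    intro k hk
    have := homogeneousComponent_succ_mul ha g k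
    rw [homogeneousComponent_of_mem ((mem_homogeneousSubmodule _ _).2 h),
      if_neg (by omega)] at this
    exact (mul_eq_zero.1 this.symm).resolve_left ha0
  rw [← sum_homogeneousComponent g]
  refine IsHomogeneous.sum _ _ _ fun k _ => ?_
  by_cases hkd : k = d
  · subst hkd
    exact homogeneousComponent_isHomogeneous _ _
  · rw [hk k hkd]
    exact isHomogeneous_zero _ _ _

/-- The degree-zero case of the division: a multiple of a linear form has no component of degree
zero. -/
theorem eq_zero_of_mul_isHomogeneous_zero {a g : MvPolynomial σ R} (ha : a.IsHomogeneous 1)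
    (ha0 : a ≠ 0) (h : (a * g).IsHomogeneous 0) : g = 0 := by
  rw [← sum_homogeneousComponent g]
  refine Finset.sum_eq_zero fun k _ => ?_
  have := homogeneousComponent_succ_mul ha g k
  rw [homogeneousComponent_of_mem ((mem_homogeneousSubmodule _ _).2 h),
    if_neg (by omega)] at this
  exact (mul_eq_zero.1 this.symm).resolve_left ha0

end Division

theorem homogTX_X_sub_C {y : CoeffT} (hy : y.IsHomogeneous 1) (i : ℕ) :
    HomogTX 1 (X i - C y) := (homogTX_X i).sub (homogTX_C hy)

theorem sumAlgEquiv_symm_X_sub_C_ne_zero (y : CoeffT) (i : ℕ) :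
    (sumAlgEquiv ℤ ℕ ℕ).symm (X i - C y) ≠ 0 := by
  rw [Ne, map_eq_zero_iff _ (sumAlgEquiv ℤ ℕ ℕ).symm.injective]
  exact X_sub_C_ne_zero y i

theorem HomogTX.trimOp {y : CoeffT} (hy : y.IsHomogeneous 1) (i : ℕ) {d : ℕ} {f : PolyTX}
    (hf : HomogTX (d + 1) f) : HomogTX d (trimOp y i f) := by
  refine isHomogeneous_of_mul (homogTX_X_sub_C hy i) (sumAlgEquiv_symm_X_sub_C_ne_zero y i) ?_
  rw [← map_mul, trimOp_spec]
  exact (hf.ins hy _).sub (hf.ins hy _)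

theorem HomogTX.trimOp_eq_zero {y : CoeffT} (hy : y.IsHomogeneous 1) (i : ℕ) {f : PolyTX}
    (hf : HomogTX 0 f) : EQSymPoly.trimOp y i f = 0 := by
  rw [← map_eq_zero_iff _ (sumAlgEquiv ℤ ℕ ℕ).symm.injective]
  refine eq_zero_of_mul_isHomogeneous_zero (homogTX_X_sub_C hy i)
    (sumAlgEquiv_symm_X_sub_C_ne_zero y i) ?_
  rw [← map_mul, trimOp_spec]
  exact (hf.ins hy _).sub (hf.ins hy _)

/-- Each trimming lowers the joint degree by one, and evaluation at linear forms preserves it. -/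
theorem HomogTX.coeffFun {τ : ℕ → CoeffT} (hτ : ∀ i, (τ i).IsHomogeneous 1) (e : ℕ →₀ ℕ)
    {k : ℕ} {f : PolyTX} (hf : HomogTX (e.degree + k) f) : (coeffFun τ e f).IsHomogeneous k := by
  induction e using graft_induction generalizing τ f with
  | h0 =>
    rw [coeffFun_zero]
    simpa using hf.aeval hτ
  | h e i ih =>
    rw [coeffFun_graft]
    refine ih (fun j => hτ _) (HomogTX.trimOp (hτ i) i ?_)
    rw [degree_graft] at hf
    rwa [add_right_comm]

theorem HomogTX.coeffFun_eq_zero {τ : ℕ → CoeffT} (hτ : ∀ i, (τ i).IsHomogeneous 1)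
    (e : ℕ →₀ ℕ) {d : ℕ} {f : PolyTX} (hf : HomogTX d f) (hd : d < e.degree) :
    EQSymPoly.coeffFun τ e f = 0 := by
  induction e using graft_induction generalizing τ f d with
  | h0 => simp at hd
  | h e i ih =>
    rw [coeffFun_graft]
    rw [degree_graft] at hd
    cases d with
    | zero => rw [hf.trimOp_eq_zero (hτ i), map_zero]
    | succ d => exact ih (fun j => hτ _) (hf.trimOp (hτ i) i) (by omega)

theorem isHomogeneous_tvar (i : ℕ) : (tvar i).IsHomogeneous 1 := isHomogeneous_X _ _

/-! ### Integration of a compatible system of divided differences -/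

section Integration

variable {R : Type*} [CommRing R]

/-- A preimage of `g` under all divided differences at `y = 0` together. -/
def integrate (N : ℕ) (g : ℕ → MvPolynomial ℕ R) : MvPolynomial ℕ R :=
  ∑ k ∈ Finset.range N, (ins (0 : R) 0)^[k] (∑ i ∈ Finset.range N, X i * g i)

/-- Insertion of `0` does not change the value at the origin, where each `X i * g i` vanishes. -/
theorem aeval_integrate (N : ℕ) (g : ℕ → MvPolynomial ℕ R) :
    aeval (0 : ℕ → R) (integrate N g) = 0 := by
  have hk : ∀ (k : ℕ) (h : MvPolynomial ℕ R),
      aeval (0 : ℕ → R) ((ins (0 : R) 0)^[k] h) = aeval (0 : ℕ → R) h := by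
    have h0 : (aeval (0 : ℕ → R)).comp (ins (0 : R) 0) = aeval (0 : ℕ → R) := by
      apply MvPolynomial.algHom_ext
      intro j
      rw [AlgHom.comp_apply]
      rcases Nat.eq_zero_or_pos j with rfl | hj
      · rw [ins_X_self]
        simp
      · rw [ins_X_of_gt _ hj]
        simp
    intro k
    induction k with
    | zero => intro h; rfl
    | succ k ih =>
      intro h
      rw [Function.iterate_succ_apply, ih]
      exact DFunLike.congr_fun h0 h
  rw [integrate, map_sum]
  refine Finset.sum_eq_zero fun k _ => ?_
  rw [hk, map_sum]
  refine Finset.sum_eq_zero fun i _ => ?_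
  simp

variable [IsDomain R]

theorem trimOp_ins_zero (y z : R) (j : ℕ) (f : MvPolynomial ℕ R) :
    trimOp z j (ins y 0 f) = ins y 0 (trimOp z (j + 1) f) := by
  apply trimOp_eq_of_mul_eq
  have := congrArg (ins y 0) (trimOp_spec z (j + 1) f)
  rw [map_mul, map_sub, map_sub, ins_X_of_gt _ (Nat.succ_pos j), ins_C, Nat.succ_sub_one,
    ins_comp_ins _ _ (Nat.zero_le _), ins_comp_ins _ _ (Nat.zero_le _)] at this
  exact this

/-- By compatibility, the terms with `i < j` telescope in insertions into `g (j + 1)`, and those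
with `i > j + 1` in insertions into `g j`. The terms `i = j` and `i = j + 1` cancel the inner
endpoints, leaving an error `ins 0 0 (g (j + 1))`. -/
theorem trimOp_sum_X_mul {g : ℕ → MvPolynomial ℕ R} {N : ℕ} (hN : ∀ i, N ≤ i → g i = 0)
    (hg : ∀ i j, j < i → trimOp (0 : R) i (g j) = trimOp 0 j (g (i + 1))) (j : ℕ) :
    trimOp (0 : R) j (∑ i ∈ Finset.range N, X i * g i) = g j - ins 0 0 (g (j + 1)) := by
  obtain ⟨M, hM⟩ := exists_mem_supported_lt (g j)
  -- The range is extended by zero terms until the last insertion, at `j + 1 + (M + N)`, lies beyond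
  -- all variables of `g j`.
  have hext : ∑ i ∈ Finset.range N, X i * g i =
      ∑ i ∈ Finset.range (j + (2 + (M + N))), X i * g i := by
    refine Finset.sum_subset (Finset.range_mono (by omega)) fun i _ hi => ?_
    rw [hN i (by simpa using hi), mul_zero]
  have hs : ∀ (i : ℕ) (h : MvPolynomial ℕ R),
      X i * trimOp (0 : R) i h = ins 0 (i + 1) h - ins 0 i h := by
    intro i h
    rw [← trimOp_spec, C_0, sub_zero]
  have h1 : ∀ i, i < j → trimOp (0 : R) j (X i * g i) =
      ins 0 (i + 1) (g (j + 1)) - ins 0 i (g (j + 1)) := by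
    intro i hi
    rw [trimOp_X_mul_of_lt _ hi, hg j i hi, hs]
  have h2 : trimOp (0 : R) j (X j * g j) = ins 0 (j + 1) (g j) := by
    apply trimOp_eq_of_mul_eq
    rw [map_mul, map_mul, ins_X_self, ins_X_of_lt _ (Nat.lt_succ_self j), C_0]
    ring
  have h3 : trimOp (0 : R) j (X (j + 1) * g (j + 1)) = - ins 0 j (g (j + 1)) := by
    apply trimOp_eq_of_mul_eq
    rw [map_mul, map_mul, ins_X_self, ins_X_of_gt _ (Nat.lt_succ_self j), C_0, Nat.succ_sub_one]
    ring
  have h4 : ∀ i, trimOp (0 : R) j (X (j + (2 + i)) * g (j + (2 + i))) =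
      ins 0 (j + 1 + (i + 1)) (g j) - ins 0 (j + 1 + i) (g j) := by
    intro i
    rw [show j + 1 + (i + 1) = (j + 1 + i) + 1 by ring, ← hs, hg _ _ (by omega)]
    apply trimOp_eq_of_mul_eq
    have := trimOp_spec (0 : R) j (g (j + (2 + i)))
    rw [map_mul, map_mul, ins_X_of_gt _ (by omega), ins_X_of_gt _ (by omega),
      show j + (2 + i) - 1 = j + 1 + i by omega, show j + 1 + i + 1 = j + (2 + i) by omega]
    linear_combination X (j + 1 + i) * this
  rw [hext, map_sum, Finset.sum_range_add, Finset.sum_range_add,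
    Finset.sum_congr rfl fun i hi => h1 i (Finset.mem_range.1 hi), Finset.sum_range_sub
      (fun i => ins (0 : R) i (g (j + 1))), Finset.sum_congr rfl fun i _ => h4 i,
    Finset.sum_range_sub (fun i => ins (0 : R) (j + 1 + i) (g j)), Finset.sum_range_succ,
    Finset.sum_range_one, add_zero, h2, h3,
    ins_of_supported (f := g j) (i := j + 1 + (M + N)) _ (by omega) hM]
  ring

/-- The error term of `trimOp_sum_X_mul` is removed by summing over iterated insertions of `0` at
the front: these turn `E_{j+k}` into `E_j`, so the sum telescopes, and `g (j + N) = 0`. -/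
theorem trimOp_integrate {g : ℕ → MvPolynomial ℕ R} {N : ℕ} (hN : ∀ i, N ≤ i → g i = 0)
    (hg : ∀ i j, j < i → trimOp (0 : R) i (g j) = trimOp 0 j (g (i + 1))) (j : ℕ) :
    trimOp (0 : R) j (integrate N g) = g j := by
  have hk : ∀ (k j : ℕ) (h : MvPolynomial ℕ R),
      trimOp (0 : R) j ((ins (0 : R) 0)^[k] h) = (ins (0 : R) 0)^[k] (trimOp 0 (j + k) h) := by
    intro k
    induction k with
    | zero => intro j h; rfl
    | succ k ih =>
      intro j h
      rw [Function.iterate_succ_apply', Function.iterate_succ_apply', trimOp_ins_zero, ih,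
        add_assoc, add_comm 1 k]
  have hsub : ∀ k, trimOp (0 : R) j ((ins (0 : R) 0)^[k] (∑ i ∈ Finset.range N, X i * g i)) =
      (ins (0 : R) 0)^[k] (g (j + k)) - (ins (0 : R) 0)^[k + 1] (g (j + (k + 1))) := by
    intro k
    rw [hk, trimOp_sum_X_mul hN hg, Function.iterate_succ_apply, iterate_map_sub]
    rfl
  rw [integrate, map_sum, Finset.sum_congr rfl fun k _ => hsub k,
    Finset.sum_range_sub' (fun k => (ins (0 : R) 0)^[k] (g (j + k))), hN _ (Nat.le_add_left N j),
    iterate_map_zero]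
  simp

end Integration

theorem HomogTX.integrate {d : ℕ} {g : ℕ → PolyTX} (hg : ∀ i, HomogTX d (g i)) (N : ℕ) :
    HomogTX (d + 1) (integrate N g) := by
  refine HomogTX.sum _ fun k hk => ?_
  clear hk
  induction k with
  | zero =>
    refine HomogTX.sum _ fun i _ => ?_
    rw [add_comm]
    exact (homogTX_X i).mul (hg i)
  | succ k ih =>
    rw [Function.iterate_succ_apply']
    exact HomogTX.ins (isHomogeneous_zero _ _ _) 0 ih

/-! ### Existence of the dual families at `τ = 0` and at `τ = t` -/

theorem coeffFun_one {R : Type*} [CommRing R] [IsDomain R] (τ : ℕ → R) (e : ℕ →₀ ℕ) :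
    coeffFun τ e 1 = if e = 0 then 1 else 0 := by
  rcases eq_zero_or_exists_graft e with rfl | ⟨i, e, rfl⟩
  · simp [coeffFun_zero]
  · rw [coeffFun_graft, ← C_1, trimOp_C, map_zero, if_neg (graft_ne_zero _ _)]

/-- The forest polynomials. -/
theorem exists_forestPoly (c : ℕ →₀ ℕ) : ∃ p : PolyTX, HomogTX c.degree p ∧
    ∀ e, coeffFun (0 : ℕ → CoeffT) e p = if e = c then 1 else 0 := by
  induction hd : c.degree generalizing c with
  | zero =>
    rw [(Finsupp.degree_eq_zero_iff c).1 hd]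
    exact ⟨1, homogTX_C (isHomogeneous_one _ _), coeffFun_one _⟩
  | succ d ih =>
    -- The prescribed divided differences: the polynomial of the pruned code when `i` is a descent
    -- of `c`, and zero otherwise.
    have hex : ∀ i, ∃ g : PolyTX, HomogTX d g ∧
        ∀ e, coeffFun (0 : ℕ → CoeffT) e g = if graft e i = c then 1 else 0 := by
      intro i
      by_cases h : ∃ e, c = graft e i
      · obtain ⟨u, rfl⟩ := h
        rw [degree_graft] at hd
        obtain ⟨p, hp, hp'⟩ := ih u (by omega)
        refine ⟨p, hp, fun e => ?_⟩
        have hu : graft e i = graft u i ↔ e = u := (graft_injective i).eq_iff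
        simp only [hp', hu]
      · exact ⟨0, HomogTX.zero d, fun e => by
          rw [map_zero, if_neg fun he => h ⟨e, he.symm⟩]⟩
    choose g hg hg' using hex
    obtain ⟨n, hn⟩ := c.support.bddAbove
    have hN : ∀ i, n + 1 ≤ i → g i = 0 := by
      intro i hi
      refine eq_zero_of_coeffFun (0 : ℕ → CoeffT) fun e => ?_
      rw [hg', if_neg]
      rintro rfl
      have : i ∈ (graft e i).support := by
        rw [Finsupp.mem_support_iff, graft_self]
        exact Nat.succ_ne_zero _
      have := hn this
      omega
    -- All functionals agree on the two sides: by `graft_comm` both test whether the same twofold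
    -- graft equals `c`.
    have hcompat : ∀ i j, j < i →
        trimOp (0 : CoeffT) i (g j) = trimOp 0 j (g (i + 1)) := by
      intro i j hij
      refine eq_of_coeffFun (0 : ℕ → CoeffT) fun e => ?_
      have h1 := coeffFun_graft (0 : ℕ → CoeffT) e i (g j)
      have h2 := coeffFun_graft (0 : ℕ → CoeffT) e j (g (i + 1))
      rw [hg', graft_comm _ hij] at h1
      rw [hg'] at h2
      exact h1.symm.trans h2
    refine ⟨integrate (n + 1) g, HomogTX.integrate hg _, fun e => ?_⟩
    rcases eq_zero_or_exists_graft e with rfl | ⟨i, e, rfl⟩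
    · rw [coeffFun_zero, aeval_integrate, if_neg]
      rintro rfl
      simp at hd
    · rw [coeffFun_graft, ← hg']
      exact congrArg _ (trimOp_integrate hN hcompat i)

theorem eq_C_eval_of_isHomogeneous_zero {a : CoeffT} (ha : a.IsHomogeneous 0) :
    a = C (eval (fun _ => 0) a) := by
  rw [← totalDegree_zero_iff_isHomogeneous, totalDegree_eq_zero_iff_eq_C] at ha
  rw [ha]
  simp

/-- In equal degree the coefficient is homogeneous of degree `0` in `t`, hence an integer; it can be
computed after setting `t = 0`, where the alphabets `tvar` and `0` agree. -/
theorem coeffFun_tvar_of_degree_eq {c : ℕ →₀ ℕ} {p : PolyTX} (hp : HomogTX c.degree p)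
    (hp' : ∀ e, coeffFun (0 : ℕ → CoeffT) e p = if e = c then 1 else 0) {e : ℕ →₀ ℕ}
    (he : e.degree = c.degree) : coeffFun tvar e p = if e = c then 1 else 0 := by
  have h0 : (coeffFun tvar e p).IsHomogeneous 0 :=
    HomogTX.coeffFun isHomogeneous_tvar e (by rwa [add_zero, he])
  rw [eq_C_eval_of_isHomogeneous_zero h0, map_coeffFun]
  have h1 := congrArg (eval (fun _ => (0 : ℤ))) (hp' e)
  rw [map_coeffFun] at h1
  have h2 : (fun i => eval (fun _ => (0 : ℤ)) (tvar i)) =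
      fun i => eval (fun _ => (0 : ℤ)) ((0 : ℕ → CoeffT) i) := by
    funext i
    simp [tvar]
  rw [h2, h1]
  split_ifs <;> simp

/-- At `τ = t` the forest polynomial `q c` has the right coefficients in degrees `≥ c.degree`. The
wrong ones in degree `d = c.degree - (k + 1)` are removed by subtracting multiples of the `q u` with
`u.degree = d`, which does not affect higher degrees. -/
theorem exists_doubleForestPoly (c : ℕ →₀ ℕ) : ∃ p : PolyTX, HomogTX c.degree p ∧
    ∀ e, coeffFun tvar e p = if e = c then 1 else 0 := by
  choose q hq hq' using exists_forestPoly
  have key : ∀ k, ∃ p : PolyTX, HomogTX c.degree p ∧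
      ∀ e : ℕ →₀ ℕ, c.degree ≤ e.degree + k → coeffFun tvar e p = if e = c then 1 else 0 := by
    intro k
    induction k with
    | zero =>
      refine ⟨q c, hq c, fun e he => ?_⟩
      rcases he.eq_or_lt with he | he
      · exact coeffFun_tvar_of_degree_eq (hq c) (hq' c) he.symm
      · rw [(hq c).coeffFun_eq_zero isHomogeneous_tvar e he, if_neg]
        rintro rfl
        simp at he
    | succ k ih =>
      obtain ⟨p, hp, hp'⟩ := ih
      by_cases hk : c.degree < k + 1
      -- Here `c.degree ≤ k`, so the previous stage already covers every code.
      · exact ⟨p, hp, fun e _ => hp' e (by omega)⟩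
      rw [not_lt] at hk
      obtain ⟨d, hd⟩ := Nat.exists_eq_add_of_le' hk
      set s : Finset (ℕ →₀ ℕ) :=
        (finite_coeffFun_ne_zero tvar p).toFinset.filter fun e => e.degree = d with hs
      have hsd : ∀ e ∈ s, e.degree = d := fun e he => (Finset.mem_filter.1 he).2
      refine ⟨p - ∑ u ∈ s, C (coeffFun tvar u p) * q u, hp.sub (HomogTX.sum _ fun u hu => ?_),
        fun e he => ?_⟩
      · have hu' := hsd u hu
        have h1 : HomogTX (u.degree + (k + 1)) p := by rwa [hu', ← hd]
        have := (homogTX_C (HomogTX.coeffFun isHomogeneous_tvar u h1)).mul (hq u)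
        rwa [hu', add_comm, ← hd] at this
      · have hterm : ∀ u, coeffFun tvar e (C (coeffFun tvar u p) * q u) =
            coeffFun tvar u p * coeffFun tvar e (q u) := by
          intro u
          rw [← smul_eq_C_mul, map_smul, smul_eq_mul]
        rw [map_sub, map_sum, Finset.sum_congr rfl fun u _ => hterm u]
        rcases (show d ≤ e.degree by omega).eq_or_lt with hed | hed
        · have hval : ∀ u ∈ s, coeffFun tvar u p * coeffFun tvar e (q u) =
              if u = e then coeffFun tvar e p else 0 := by
            intro u hu
            rw [coeffFun_tvar_of_degree_eq (hq u) (hq' u) (by rw [← hed, hsd u hu])]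
            by_cases h : u = e
            · subst h
              simp
            · rw [if_neg (Ne.symm h), if_neg h, mul_zero]
          rw [Finset.sum_congr rfl hval, Finset.sum_ite_eq', if_neg (c := e = c)]
          · split_ifs with h
            · rw [sub_self]
            · rw [sub_zero]
              by_contra h0
              exact h (by simp [hs, h0, hed])
          · rintro rfl
            omega
        · rw [Finset.sum_eq_zero, sub_zero]
          · exact hp' e (by omega)
          · intro u hu
            rw [(hq u).coeffFun_eq_zero isHomogeneous_tvar e (by rw [hsd u hu]; exact hed),
              mul_zero]
  obtain ⟨p, hp, hp'⟩ := key c.degree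
  exact ⟨p, hp, fun e => hp' e (by omega)⟩

/-- The double forest polynomial of a code. -/
def codePoly (c : ℕ →₀ ℕ) : PolyTX := Classical.choose (exists_doubleForestPoly c)

theorem homogTX_codePoly (c : ℕ →₀ ℕ) : HomogTX c.degree (codePoly c) :=
  (Classical.choose_spec (exists_doubleForestPoly c)).1

theorem coeffFun_codePoly (c e : ℕ →₀ ℕ) :
    coeffFun tvar e (codePoly c) = if e = c then 1 else 0 :=
  (Classical.choose_spec (exists_doubleForestPoly c)).2 e

/-! ### Codes of trees -/

/-- The leaf reached by left edges is never the last leaf of the tree, hence the strict bound on `i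
+ 1`. Consequently the last leaf always has code entry `0`. -/
theorem mem_treeFlags {o i : ℕ} {T : BinaryTree Unit} (h : i ∈ treeFlags o T) :
    o ≤ i ∧ i + 1 < o + T.numLeaves := by
  induction T generalizing o with
  | nil => simp [treeFlags] at h
  | node a l r ihl ihr =>
    have hl := l.numLeaves_pos
    have hr := r.numLeaves_pos
    rw [treeFlags, Multiset.mem_cons, Multiset.mem_add] at h
    rw [BinaryTree.numLeaves]
    rcases h with rfl | h | h
    · omega
    · have := ihl h
      omega
    · have := ihr h
      omega

theorem count_treeFlags_eq_zero {o i : ℕ} {T : BinaryTree Unit}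
    (h : i < o ∨ o + T.numLeaves ≤ i + 1) : (treeFlags o T).count i = 0 := by
  rw [Multiset.count_eq_zero]
  intro hi
  have := mem_treeFlags hi
  omega

theorem count_treeFlags_node (o i : ℕ) (a : Unit) (l r : BinaryTree Unit) :
    (treeFlags o (.node a l r)).count i = (if i = o then 1 else 0) + (treeFlags o l).count i +
      (treeFlags (o + l.numLeaves) r).count i := by
  rw [treeFlags, Multiset.count_cons, Multiset.count_add]
  ring

theorem count_treeFlags_self_pos {o : ℕ} {T : BinaryTree Unit} (h : T ≠ .nil) :
    0 < (treeFlags o T).count o := by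
  cases T with
  | nil => exact absurd rfl h
  | node a l r =>
    rw [count_treeFlags_node, if_pos rfl]
    omega

theorem treeFlags_succ (o : ℕ) (T : BinaryTree Unit) :
    treeFlags (o + 1) T = (treeFlags o T).map Nat.succ := by
  induction T generalizing o with
  | nil => rfl
  | node a l r ihl ihr =>
    rw [treeFlags, treeFlags, Multiset.map_cons, Multiset.map_add, ← ihl, ← ihr,
      add_right_comm]

theorem count_treeFlags_succ (o i : ℕ) (T : BinaryTree Unit) :
    (treeFlags (o + 1) T).count (i + 1) = (treeFlags o T).count i := by
  rw [treeFlags_succ]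
  exact Multiset.count_map_eq_count' _ _ Nat.succ_injective i

/-- The nodes with flag `i` form a left chain above leaf `i`. The lowest one is terminal exactly
when its right subtree, whose first leaf is `i + 1`, is a leaf, that is, when no node has flag `i +
1`. -/
theorem mem_treeTerminalFlags_iff {o i : ℕ} {T : BinaryTree Unit} :
    i ∈ treeTerminalFlags o T ↔
      0 < (treeFlags o T).count i ∧ (treeFlags o T).count (i + 1) = 0 := by
  induction T generalizing o with
  | nil => simp [treeTerminalFlags, treeFlags]
  | node a l r ihl ihr =>
    have hlpos := l.numLeaves_pos
    rw [treeTerminalFlags, count_treeFlags_node, count_treeFlags_node]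
    split_ifs with h h1 h2 h2
    · omega
    · obtain ⟨rfl, rfl⟩ := h
      simp [treeFlags, h1]
    · obtain ⟨rfl, rfl⟩ := h
      simp [treeFlags, h1]
    · obtain ⟨rfl, rfl⟩ := h
      simp [treeFlags, h1]
    all_goals rw [Set.mem_union, ihl, ihr]
    · omega
    · subst_vars
      -- The root has flag `o` but is not terminal. Either the right subtree is nontrivial and
      -- supplies the flag `o + 1`, or the left subtree has flag `o` as well and decides.
      by_cases hl : l = .nil
      · subst hl
        have hr : r ≠ .nil := fun hr => h ⟨rfl, hr⟩
        have := count_treeFlags_self_pos (o := o + 1) hr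
        have h3 : (treeFlags (o + 1) r).count o = 0 := count_treeFlags_eq_zero (Or.inl (by omega))
        simp only [treeFlags, BinaryTree.numLeaves, Multiset.count_zero]
        omega
      · have h1 := count_treeFlags_self_pos (o := o) hl
        have h3 : (treeFlags (o + l.numLeaves) r).count o = 0 :=
          count_treeFlags_eq_zero (Or.inl (by omega))
        have h4 : (treeFlags (o + l.numLeaves) r).count (o + 1) = 0 := by
          apply count_treeFlags_eq_zero
          have := mem_treeFlags (Multiset.count_pos.1 h1)
          omega
        omega
    · have h3 : (treeFlags o l).count i = 0 := count_treeFlags_eq_zero (Or.inl (by omega))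
      have h4 : (treeFlags (o + l.numLeaves) r).count i = 0 :=
        count_treeFlags_eq_zero (Or.inl (by omega))
      omega
    · rcases lt_or_ge i (o + l.numLeaves) with hi | hi
      · have h3 : (treeFlags (o + l.numLeaves) r).count i = 0 :=
          count_treeFlags_eq_zero (Or.inl hi)
        by_cases h5 : 0 < (treeFlags o l).count i
        · have h4 : (treeFlags (o + l.numLeaves) r).count (i + 1) = 0 := by
            apply count_treeFlags_eq_zero
            have := mem_treeFlags (Multiset.count_pos.1 h5)
            omega
          omega
        · omega
      · have h3 : (treeFlags o l).count i = 0 := count_treeFlags_eq_zero (Or.inr (by omega))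
        have h4 : (treeFlags o l).count (i + 1) = 0 := count_treeFlags_eq_zero (Or.inr (by omega))
        omega

theorem range_of_mem_treeTerminalFlags {o i : ℕ} {T : BinaryTree Unit}
    (h : i ∈ treeTerminalFlags o T) : o ≤ i ∧ i + 1 < o + T.numLeaves :=
  mem_treeFlags (Multiset.count_pos.1 (mem_treeTerminalFlags_iff.1 h).1)

theorem treeTrim_of_notMem {o i : ℕ} {T : BinaryTree Unit} (h : i ∉ treeTerminalFlags o T) :
    treeTrim i o T = T := by
  induction T generalizing o with
  | nil => rfl
  | node a l r ihl ihr =>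
    rw [treeTerminalFlags] at h
    rw [treeTrim]
    split_ifs at h with h1
    · rw [if_pos h1, if_neg]
      rintro rfl
      exact h rfl
    · rw [if_neg h1, ihl fun hl => h (Or.inl hl), ihr fun hr => h (Or.inr hr)]

theorem treeTrim_of_mem {o i : ℕ} {T : BinaryTree Unit} (h : i ∈ treeTerminalFlags o T) :
    (treeTrim i o T).numLeaves + 1 = T.numLeaves ∧
    ∀ j, (treeFlags o (treeTrim i o T)).count j = if j < i then (treeFlags o T).count j else
      if j = i then (treeFlags o T).count i - 1 else (treeFlags o T).count (j + 1) := by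
  induction T generalizing o with
  | nil => simp [treeTerminalFlags] at h
  | node a l r ihl ihr =>
    have hlpos := l.numLeaves_pos
    rw [treeTerminalFlags] at h
    rw [treeTrim]
    split_ifs at h with h1
    · obtain rfl : i = o := h
      obtain ⟨rfl, rfl⟩ := h1
      rw [if_pos ⟨rfl, rfl⟩, if_pos rfl]
      refine ⟨rfl, fun j => ?_⟩
      simp only [treeFlags, Multiset.count_zero, Multiset.count_cons, add_zero]
      split_ifs <;> omega
    · rw [if_neg h1]
      rcases h with h | h
      · have hi := range_of_mem_treeTerminalFlags h
        have hr : i ∉ treeTerminalFlags (o + l.numLeaves) r := fun hr => by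
          have := range_of_mem_treeTerminalFlags hr
          omega
        rw [treeTrim_of_notMem hr]
        obtain ⟨hn, hc⟩ := ihl h
        have hpos := (mem_treeTerminalFlags_iff.1 h).1
        refine ⟨by rw [BinaryTree.numLeaves, BinaryTree.numLeaves]; omega, fun j => ?_⟩
        -- Trimming in the left subtree lowers all leaf labels of the right one by one.
        have hshift := count_treeFlags_succ (o + (treeTrim i o l).numLeaves) j r
        rw [add_assoc, hn] at hshift
        simp only [count_treeFlags_node, hc, ← hshift]
        rcases lt_trichotomy j i with hj | rfl | hj
        · have h3 : (treeFlags (o + l.numLeaves) r).count j = 0 :=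
            count_treeFlags_eq_zero (Or.inl (by omega))
          have h4 : (treeFlags (o + l.numLeaves) r).count (j + 1) = 0 :=
            count_treeFlags_eq_zero (Or.inl (by omega))
          rw [if_pos hj, if_pos hj, h3, h4]
        · have h3 : (treeFlags (o + l.numLeaves) r).count j = 0 :=
            count_treeFlags_eq_zero (Or.inl (by omega))
          have h4 : (treeFlags (o + l.numLeaves) r).count (j + 1) = 0 :=
            count_treeFlags_eq_zero (Or.inl (by omega))
          simp only [lt_irrefl, if_false, if_true, h3, h4]
          omega
        · rw [if_neg (by omega), if_neg (by omega), if_neg (by omega), if_neg (by omega),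
            if_neg (by omega), if_neg (by omega)]
      · have hi := range_of_mem_treeTerminalFlags h
        have hl : i ∉ treeTerminalFlags o l := fun hl => by
          have := range_of_mem_treeTerminalFlags hl
          omega
        rw [treeTrim_of_notMem hl]
        obtain ⟨hn, hc⟩ := ihr h
        refine ⟨by rw [BinaryTree.numLeaves, BinaryTree.numLeaves]; omega, fun j => ?_⟩
        simp only [count_treeFlags_node, hc]
        rcases lt_trichotomy j i with hj | rfl | hj
        · rw [if_pos hj, if_pos hj]
        · have h3 : (treeFlags o l).count j = 0 := count_treeFlags_eq_zero (Or.inr (by omega))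
          have h4 : j ≠ o := by omega
          simp only [lt_irrefl, if_false, if_true, h3, h4]
          omega
        · have h3 : (treeFlags o l).count j = 0 := count_treeFlags_eq_zero (Or.inr (by omega))
          have h4 : (treeFlags o l).count (j + 1) = 0 :=
            count_treeFlags_eq_zero (Or.inr (by omega))
          rw [if_neg (by omega), if_neg (by omega), if_neg (by omega), if_neg (by omega),
            if_neg (by omega), if_neg (by omega), h3, h4]

/-- The code of the tree `T` is read off the sequence `c` from position `o` on. -/
def Reads (c : ℕ → ℕ) (o : ℕ) (T : BinaryTree Unit) : Prop :=
  ∀ i, o ≤ i → i < o + T.numLeaves → (treeFlags o T).count i = c i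

theorem reads_nil {c : ℕ → ℕ} {o : ℕ} (h : c o = 0) : Reads c o .nil := by
  intro i hi hi'
  rw [BinaryTree.numLeaves] at hi'
  obtain rfl : i = o := by omega
  rw [h]
  rfl

/-- Parsing rule: the root consumes one unit of `c o`, the left subtree is read from the rest, and
the right subtree from the next unread position. -/
theorem reads_node {c : ℕ → ℕ} {o : ℕ} {a : Unit} {l r : BinaryTree Unit} :
    Reads c o (.node a l r) ↔ 0 < c o ∧ Reads (Function.update c o (c o - 1)) o l ∧
      Reads c (o + l.numLeaves) r := by
  have hlpos := l.numLeaves_pos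
  constructor
  · intro h
    simp only [Reads, BinaryTree.numLeaves, count_treeFlags_node] at h
    have h0 := h o le_rfl (by omega)
    rw [if_pos rfl] at h0
    refine ⟨by omega, fun i hi hi' => ?_, fun i hi hi' => ?_⟩
    · have h2 := h i hi (by omega)
      have h3 : (treeFlags (o + l.numLeaves) r).count i = 0 :=
        count_treeFlags_eq_zero (Or.inl (by omega))
      by_cases hio : i = o
      · subst hio
        rw [Function.update_self]
        omega
      · rw [Function.update_of_ne hio]
        rw [if_neg hio] at h2
        omega
    · have h2 := h i (by omega) (by omega)
      have h3 : (treeFlags o l).count i = 0 := count_treeFlags_eq_zero (Or.inr (by omega))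
      rw [if_neg (by omega)] at h2
      omega
  · rintro ⟨h0, hl, hr⟩ i hi hi'
    rw [BinaryTree.numLeaves] at hi'
    rw [count_treeFlags_node]
    rcases lt_or_ge i (o + l.numLeaves) with h | h
    · have h2 := hl i hi h
      have h3 : (treeFlags (o + l.numLeaves) r).count i = 0 :=
        count_treeFlags_eq_zero (Or.inl (by omega))
      by_cases hio : i = o
      · subst hio
        rw [Function.update_self] at h2
        rw [if_pos rfl]
        omega
      · rw [Function.update_of_ne hio] at h2
        rw [if_neg hio]
        omega
    · have h2 := hr i h (by omega)
      have h3 : (treeFlags o l).count i = 0 := count_treeFlags_eq_zero (Or.inr (by omega))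
      rw [if_neg (by omega)]
      omega

theorem Reads.apply_eq_zero {c : ℕ → ℕ} {o : ℕ} (h : Reads c o .nil) : c o = 0 := by
  rw [← h o le_rfl (by simp [BinaryTree.numLeaves])]
  rfl

/-- Parsing is deterministic: `c o = 0` forces a leaf and `c o > 0` forces a node. -/
theorem Reads.unique {c : ℕ → ℕ} {o : ℕ} {T T' : BinaryTree Unit} (h : Reads c o T)
    (h' : Reads c o T') : T = T' := by
  induction T generalizing c o T' with
  | nil =>
    cases T' with
    | nil => rfl
    | node a l r => exact absurd h.apply_eq_zero (reads_node.1 h').1.ne'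
  | node a l r ihl ihr =>
    cases T' with
    | nil => exact absurd h'.apply_eq_zero (reads_node.1 h).1.ne'
    | node a' l' r' =>
      obtain ⟨-, hl, hr⟩ := reads_node.1 h
      obtain ⟨-, hl', hr'⟩ := reads_node.1 h'
      obtain rfl := ihl hl hl'
      obtain rfl := ihr hr hr'
      rfl

theorem exists_reads {c : ℕ → ℕ} {B : ℕ} (hB : ∀ i, B ≤ i → c i = 0) (o : ℕ) :
    ∃ T, Reads c o T := by
  induction hN : ∑ i ∈ Finset.Ico o B, c i using Nat.strong_induction_on generalizing c o with
  | _ N ih =>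
    rcases Nat.eq_zero_or_pos (c o) with h0 | h0
    · exact ⟨_, reads_nil h0⟩
    · have hoB : o < B := by
        by_contra h
        exact h0.ne' (hB o (by omega))
      have hsum := Finset.sum_eq_sum_Ico_succ_bot hoB c
      have hsum' := Finset.sum_eq_sum_Ico_succ_bot hoB (Function.update c o (c o - 1))
      have htail : ∑ i ∈ Finset.Ico (o + 1) B, Function.update c o (c o - 1) i =
          ∑ i ∈ Finset.Ico (o + 1) B, c i := Finset.sum_congr rfl fun i hi =>
        Function.update_of_ne (by have := Finset.mem_Ico.1 hi; omega) _ _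
      rw [Function.update_self, htail] at hsum'
      obtain ⟨l, hl⟩ := ih _ (by omega) (c := Function.update c o (c o - 1)) (o := o)
        (fun i hi => by rw [Function.update_of_ne (by omega), hB i hi]) rfl
      -- The right subtree starts beyond `o`, so its remaining sum omits `c o > 0` and is strictly
      -- smaller.
      have hle : ∑ i ∈ Finset.Ico (o + l.numLeaves) B, c i ≤ ∑ i ∈ Finset.Ico (o + 1) B, c i :=
        Finset.sum_le_sum_of_subset
          (Finset.Ico_subset_Ico_left (by have := l.numLeaves_pos; omega))
      obtain ⟨r, hr⟩ := ih _ (by omega) hB (o + l.numLeaves) rfl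
      exact ⟨.node () l r, reads_node.2 ⟨h0, hl, hr⟩⟩

/-! ### Codes of forests -/

namespace IndexedForest

theorem firstLeaf_succ (F : IndexedForest) (k : ℕ) :
    F.firstLeaf (k + 1) = F.firstLeaf k + (F.trees k).numLeaves := Finset.sum_range_succ _ _

theorem firstLeaf_strictMono (F : IndexedForest) : StrictMono F.firstLeaf :=
  strictMono_nat_of_lt_succ fun k => by
    rw [firstLeaf_succ]
    have := (F.trees k).numLeaves_pos
    omega

theorem exists_tree_of_leaf (F : IndexedForest) (i : ℕ) :
    ∃ k, F.firstLeaf k ≤ i ∧ i < F.firstLeaf (k + 1) := by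
  induction i with
  | zero =>
    refine ⟨0, by simp [firstLeaf], ?_⟩
    exact F.firstLeaf_strictMono (Nat.zero_lt_succ 0)
  | succ i ih =>
    obtain ⟨k, hk, hk'⟩ := ih
    by_cases h : i + 1 < F.firstLeaf (k + 1)
    · exact ⟨k, by omega, h⟩
    · refine ⟨k + 1, by omega, ?_⟩
      have := F.firstLeaf_strictMono (Nat.lt_succ_self (k + 1))
      simp only [Nat.succ_eq_add_one] at this
      omega

theorem tree_of_leaf_unique (F : IndexedForest) {i k k' : ℕ} (h1 : F.firstLeaf k ≤ i)
    (h2 : i < F.firstLeaf (k + 1)) (h1' : F.firstLeaf k' ≤ i) (h2' : i < F.firstLeaf (k' + 1)) :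
    k = k' := by
  have h3 := F.firstLeaf_strictMono.lt_iff_lt.1 (h1.trans_lt h2')
  have h4 := F.firstLeaf_strictMono.lt_iff_lt.1 (h1'.trans_lt h2)
  omega

theorem code_eq_count (F : IndexedForest) {i k : ℕ} (h1 : F.firstLeaf k ≤ i)
    (h2 : i < F.firstLeaf (k + 1)) :
    F.code i = (treeFlags (F.firstLeaf k) (F.trees k)).count i := by
  rw [code]
  refine Finset.sum_eq_single k (fun k' _ hk' => ?_) fun hk => ?_
  · apply count_treeFlags_eq_zero
    by_contra hc
    rw [← firstLeaf_succ] at hc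
    exact hk' (F.tree_of_leaf_unique (by omega) (by omega) h1 h2)
  · have := F.firstLeaf_strictMono.le_apply (x := k)
    exact absurd (Finset.mem_range.2 (by omega)) hk

theorem reads_code (F : IndexedForest) (k : ℕ) : Reads F.code (F.firstLeaf k) (F.trees k) :=
  fun i hi hi' => (F.code_eq_count hi (by rwa [firstLeaf_succ])).symm

/-- The trees are recovered from left to right: each tree is determined by its starting leaf, and it
determines the next one. -/
theorem code_injective : Function.Injective code := by
  intro F G h
  have key : ∀ k, F.firstLeaf k = G.firstLeaf k → F.trees k = G.trees k := by
    intro k hk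
    have h1 := F.reads_code k
    have h2 := G.reads_code k
    rw [h, hk] at h1
    exact h1.unique h2
  have hfl : ∀ k, F.firstLeaf k = G.firstLeaf k := by
    intro k
    induction k with
    | zero => rfl
    | succ k ih => rw [firstLeaf_succ, firstLeaf_succ, key k ih, ih]
  ext1
  funext k
  exact key k (hfl k)

/-- Trees are read off one after another; since the `k`-th starts at a position `≥ k`, it is trivial
for `k ≥ B`. -/
theorem exists_code_eq {c : ℕ → ℕ} {B : ℕ} (hB : ∀ i, B ≤ i → c i = 0) :
    ∃ F : IndexedForest, F.code = c := by
  choose T hT using exists_reads hB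
  let s : ℕ → ℕ := fun k => Nat.rec 0 (fun _ m => m + (T m).numLeaves) k
  have hs : ∀ k, s (k + 1) = s k + (T (s k)).numLeaves := fun _ => rfl
  have hk : ∀ k, k ≤ s k := by
    intro k
    induction k with
    | zero => exact Nat.zero_le _
    | succ k ih =>
      have := (T (s k)).numLeaves_pos
      rw [hs]
      omega
  let F : IndexedForest := ⟨fun k => T (s k), by
    refine (Set.finite_lt_nat B).subset fun k hk' => ?_
    by_contra h
    exact hk' ((hT (s k)).unique (reads_nil (hB _ ((not_lt.1 h).trans (hk k)))))⟩
  have hfl : ∀ k, F.firstLeaf k = s k := by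
    intro k
    induction k with
    | zero => rfl
    | succ k ih => rw [firstLeaf_succ, hs, ih]
  refine ⟨F, funext fun i => ?_⟩
  obtain ⟨k, h1, h2⟩ := F.exists_tree_of_leaf i
  rw [F.code_eq_count h1 h2]
  rw [firstLeaf_succ] at h2
  rw [hfl] at h1 h2 ⊢
  exact hT (s k) i h1 h2

theorem finite_support_code (F : IndexedForest) : F.code.support.Finite := by
  obtain ⟨n, hn⟩ := F.finite_nontrivial.bddAbove
  refine (Set.finite_lt_nat (F.firstLeaf (n + 1))).subset fun i hi => ?_
  by_contra hc
  obtain ⟨k, h1, h2⟩ := F.exists_tree_of_leaf i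
  have hk := F.firstLeaf_strictMono.lt_iff_lt.1 ((not_lt.1 hc).trans_lt h2)
  have hnil : F.trees k = .nil := by
    by_contra h
    have := hn h
    omega
  apply hi
  rw [F.code_eq_count h1 h2, hnil]
  rfl

/-- The code of an indexed forest as a finitely supported function. -/
def finCode (F : IndexedForest) : ℕ →₀ ℕ := Finsupp.ofSupportFinite F.code F.finite_support_code

theorem coe_finCode (F : IndexedForest) : ⇑F.finCode = F.code := rfl

theorem finCode_injective : Function.Injective finCode := fun F G h =>
  code_injective (by rw [← coe_finCode, h, coe_finCode])

theorem finCode_surjective : Function.Surjective finCode := by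
  intro c
  obtain ⟨n, hn⟩ := c.support.bddAbove
  obtain ⟨F, hF⟩ := exists_code_eq (c := c) (B := n + 1) fun i hi => by
    by_contra h
    have := hn (Finsupp.mem_support_iff.2 h)
    omega
  exact ⟨F, DFunLike.coe_injective hF⟩

theorem finCode_empty : finCode empty = 0 := by
  ext i
  simp [coe_finCode, code, empty, treeFlags]

theorem finCode_eq_zero_iff {F : IndexedForest} : F.finCode = 0 ↔ F = empty := by
  rw [← finCode_empty, finCode_injective.eq_iff]

theorem mem_qdes_tree {F : IndexedForest} {i : ℕ} (h : i ∈ F.qdes) :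
    ∃ k, i ∈ treeTerminalFlags (F.firstLeaf k) (F.trees k) ∧ F.firstLeaf k ≤ i ∧
      i + 1 < F.firstLeaf (k + 1) := by
  obtain ⟨k, hk⟩ := h
  have := range_of_mem_treeTerminalFlags hk
  rw [← firstLeaf_succ] at this
  exact ⟨k, hk, this⟩

/-- The local criterion applies because a flag is never the last leaf of its tree, so `i` and `i +
1` belong to the same tree. -/
theorem mem_qdes_iff {F : IndexedForest} {i : ℕ} :
    i ∈ F.qdes ↔ 0 < F.code i ∧ F.code (i + 1) = 0 := by
  constructor
  · intro h
    obtain ⟨k, hk, h1, h2⟩ := mem_qdes_tree h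
    rw [F.code_eq_count h1 (by omega), F.code_eq_count (by omega) h2]
    exact mem_treeTerminalFlags_iff.1 hk
  · rintro ⟨h, h'⟩
    obtain ⟨k, h1, h2⟩ := F.exists_tree_of_leaf i
    rw [F.code_eq_count h1 h2] at h
    have h3 := (mem_treeFlags (Multiset.count_pos.1 h)).2
    rw [← firstLeaf_succ] at h3
    rw [F.code_eq_count (by omega) h3] at h'
    exact ⟨k, mem_treeTerminalFlags_iff.2 ⟨h, h'⟩⟩

theorem mem_qdes_iff_exists_graft {F : IndexedForest} {i : ℕ} :
    i ∈ F.qdes ↔ ∃ e, F.finCode = graft e i := by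
  rw [exists_graft_iff, coe_finCode, mem_qdes_iff]

/-- Only the tree `k₀` containing leaf `i` changes; later trees keep their shape and have their
labels lowered by one. -/
theorem finCode_trim {F : IndexedForest} {i : ℕ} (h : i ∈ F.qdes) :
    (F.trim i).finCode = prune F.finCode i := by
  obtain ⟨k₀, hk₀, h1, h2⟩ := mem_qdes_tree h
  obtain ⟨hn, hc⟩ := treeTrim_of_mem hk₀
  have htree : ∀ k, (F.trim i).trees k = treeTrim i (F.firstLeaf k) (F.trees k) := fun _ => rfl
  have htree' : ∀ k, k ≠ k₀ → (F.trim i).trees k = F.trees k := by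
    intro k hk
    apply treeTrim_of_notMem
    intro hm
    have := range_of_mem_treeTerminalFlags hm
    rw [← firstLeaf_succ] at this
    exact hk (F.tree_of_leaf_unique this.1 (by omega) h1 (by omega))
  have hle : ∀ k, k ≤ k₀ → (F.trim i).firstLeaf k = F.firstLeaf k := by
    intro k
    induction k with
    | zero => intro _; rfl
    | succ k ih =>
      intro hk
      rw [firstLeaf_succ, firstLeaf_succ, ih (by omega), htree' k (by omega)]
  have hgt : ∀ k, (F.trim i).firstLeaf (k₀ + 1 + k) + 1 = F.firstLeaf (k₀ + 1 + k) := by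
    intro k
    induction k with
    | zero =>
      rw [add_zero, firstLeaf_succ, firstLeaf_succ, hle k₀ le_rfl, htree, add_assoc, hn]
    | succ k ih =>
      rw [← add_assoc, firstLeaf_succ, firstLeaf_succ, htree' _ (by omega), ← ih]
      ring
  have hgt0 := hgt 0
  rw [add_zero] at hgt0
  ext j
  rw [prune_apply, coe_finCode, coe_finCode]
  obtain ⟨k, hj1, hj2⟩ := (F.trim i).exists_tree_of_leaf j
  rw [code_eq_count _ hj1 hj2]
  rcases lt_trichotomy k k₀ with hk | rfl | hk
  · rw [hle k hk.le] at hj1 ⊢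
    rw [hle (k + 1) hk] at hj2
    have := F.firstLeaf_strictMono.monotone (show k + 1 ≤ k₀ from hk)
    rw [htree' k hk.ne, if_pos (by omega), F.code_eq_count hj1 hj2]
  · rw [hle k le_rfl] at hj1 ⊢
    rw [htree, hc]
    split_ifs with hji hji'
    · rw [F.code_eq_count hj1 (by omega)]
    · rw [F.code_eq_count h1 (by omega)]
    · rw [F.code_eq_count (k := k) (by omega) (by omega)]
  · obtain ⟨m, rfl⟩ := Nat.exists_eq_add_of_le (show k₀ + 1 ≤ k from hk)
    have h3 := hgt m
    have h4 := hgt (m + 1)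
    rw [← add_assoc] at h4
    have := (F.trim i).firstLeaf_strictMono.monotone (show k₀ + 1 ≤ k₀ + 1 + m by omega)
    rw [htree' _ hk.ne', if_neg (by omega), if_neg (by omega),
      F.code_eq_count (k := k₀ + 1 + m) (by omega) (by omega), ← h3, count_treeFlags_succ]

end IndexedForest

/-! ### Sums over weakly increasing words with prescribed strict increases -/

/-- The weakly increasing words of length `m` in the letters `0, …, n - 1` that increase strictly
at the positions in `A`. -/
def strictWords (n m : ℕ) (A : Set ℕ) : Set (Fin m → ℕ) :=
  {f | (∀ j, f j < n) ∧ Monotone f ∧ ∀ p q : Fin m, (p : ℕ) + 1 = q → (q : ℕ) ∈ A → f p < f q}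

theorem finite_strictWords (n m : ℕ) (A : Set ℕ) : (strictWords n m A).Finite :=
  (Fintype.piFinset fun _ : Fin m => Finset.range n).finite_toSet.subset fun f hf => by
    simpa using hf.1

/-- The generating function of `strictWords n m A`. -/
def wordSum (n m : ℕ) (A : Set ℕ) : MvPolynomial ℕ ℤ :=
  ∑ f ∈ (finite_strictWords n m A).toFinset, ∏ j, X (f j)

theorem init_mem_strictWords {n m : ℕ} {A : Set ℕ} {f : Fin (m + 1) → ℕ}
    (hf : f ∈ strictWords n (m + 1) A) : Fin.init f ∈ strictWords n m A :=
  ⟨fun j => hf.1 _, fun a b hab => hf.2.1 (Fin.castSucc_le_castSucc_iff.2 hab),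
    fun p q hpq hq => hf.2.2 _ _ (by simpa using hpq) (by simpa using hq)⟩

theorem init_mem_strictWords_of_mem {n m : ℕ} {A : Set ℕ} {f : Fin (m + 1) → ℕ}
    (hf : f ∈ strictWords (n + 1) (m + 1) A) (hm : m ∈ A) : Fin.init f ∈ strictWords n m A := by
  refine ⟨fun j => ?_, (init_mem_strictWords hf).2⟩
  have hj := j.isLt
  have h1 : f j.castSucc ≤ f ⟨m - 1, by omega⟩ := hf.2.1 (by
    rw [Fin.le_def]
    simp only [Fin.val_castSucc]
    omega)
  have h2 : f ⟨m - 1, by omega⟩ < f (Fin.last m) := hf.2.2 _ _ (by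
    simp only [Fin.val_last]
    omega) (by simpa using hm)
  have h3 := hf.1 (Fin.last m)
  have h4 : Fin.init f j = f j.castSucc := rfl
  omega

theorem snoc_mem_strictWords {n k m : ℕ} {A : Set ℕ} {g : Fin m → ℕ}
    (hg : g ∈ strictWords k m A) (hk : k ≤ n + 1) (hA : m ∈ A → k ≤ n) :
    (Fin.snoc g n : Fin (m + 1) → ℕ) ∈ strictWords (n + 1) (m + 1) A := by
  refine ⟨fun j => ?_, fun a b hab => ?_, fun p q hpq hq => ?_⟩
  · induction j using Fin.lastCases with
    | last => simp
    | cast j =>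
      have := hg.1 j
      rw [Fin.snoc_castSucc]
      omega
  · induction b using Fin.lastCases with
    | last =>
      induction a using Fin.lastCases with
      | last => exact le_rfl
      | cast a =>
        have := hg.1 a
        rw [Fin.snoc_castSucc, Fin.snoc_last]
        omega
    | cast b =>
      induction a using Fin.lastCases with
      | last =>
        rw [Fin.le_def, Fin.val_last, Fin.val_castSucc] at hab
        have := b.isLt
        omega
      | cast a =>
        rw [Fin.snoc_castSucc, Fin.snoc_castSucc]
        exact hg.2.1 (Fin.castSucc_le_castSucc_iff.1 hab)
  · induction p using Fin.lastCases with
    | last =>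
      have := q.isLt
      rw [Fin.val_last] at hpq
      omega
    | cast p =>
      rw [Fin.snoc_castSucc]
      induction q using Fin.lastCases with
      | last =>
        have := hg.1 p
        have := hA (by simpa using hq)
        rw [Fin.snoc_last]
        omega
      | cast q =>
        rw [Fin.snoc_castSucc]
        exact hg.2.2 _ _ (by simpa using hpq) (by simpa using hq)

theorem mem_strictWords_of_last_ne {n m : ℕ} {A : Set ℕ} {f : Fin (m + 1) → ℕ} :
    f ∈ strictWords (n + 1) (m + 1) A ∧ f (Fin.last m) ≠ n ↔ f ∈ strictWords n (m + 1) A := by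
  constructor
  · rintro ⟨hf, hl⟩
    refine ⟨fun j => ?_, hf.2⟩
    have h1 := hf.2.1 (Fin.le_last j)
    have h2 := hf.1 (Fin.last m)
    omega
  · intro hf
    exact ⟨⟨fun j => (hf.1 j).trans (Nat.lt_succ_self n), hf.2⟩, (hf.1 _).ne⟩

theorem wordSum_zero_right (n : ℕ) (A : Set ℕ) : wordSum n 0 A = 1 := by
  have : strictWords n 0 A = Set.univ :=
    Set.eq_univ_of_forall fun f => ⟨fun j => j.elim0, fun a => a.elim0, fun p => p.elim0⟩
  simp [wordSum, this]

-- Words are split by whether the last, hence largest, letter is `n`. If it is, it is removed, and a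
-- forced strict increase before it bounds the other letters by `n - 1`.
open Classical in
theorem wordSum_succ (n m : ℕ) (A : Set ℕ) :
    wordSum (n + 1) (m + 1) A = X n * (if m ∈ A then wordSum n m A else wordSum (n + 1) m A) +
      wordSum n (m + 1) A := by
  -- Here `k` is the alphabet size left after removing the last letter: `n` if a strict increase is
  -- forced there, `n + 1` otherwise.
  have key : ∀ k, k ≤ n + 1 → (m ∈ A → k ≤ n) →
      (∀ f ∈ strictWords (n + 1) (m + 1) A, Fin.init f ∈ strictWords k m A) →
      wordSum (n + 1) (m + 1) A = X n * wordSum k m A + wordSum n (m + 1) A := by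
    intro k hk hA hinit
    rw [wordSum, ← Finset.sum_filter_add_sum_filter_not _ fun f => f (Fin.last m) = n]
    congr 1
    · rw [wordSum, Finset.mul_sum]
      refine Finset.sum_bij' (fun f _ => Fin.init f) (fun g _ => Fin.snoc g n) ?_ ?_ ?_ ?_ ?_
      · intro f hf
        simp only [Finset.mem_filter, Set.Finite.mem_toFinset] at hf ⊢
        exact hinit f hf.1
      · intro g hg
        simp only [Finset.mem_filter, Set.Finite.mem_toFinset] at hg ⊢
        exact ⟨snoc_mem_strictWords hg hk hA, Fin.snoc_last _ _⟩
      · intro f hf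
        rw [← (Finset.mem_filter.1 hf).2]
        exact Fin.snoc_init_self f
      · intro g hg
        exact Fin.init_snoc _ _
      · intro f hf
        rw [Fin.prod_univ_castSucc, (Finset.mem_filter.1 hf).2, mul_comm]
        rfl
    · rw [wordSum]
      refine Finset.sum_congr ?_ fun _ _ => rfl
      ext f
      simp only [Finset.mem_filter, Set.Finite.mem_toFinset]
      exact mem_strictWords_of_last_ne
  split_ifs with hm
  · exact key n (Nat.le_succ n) (fun _ => le_rfl) fun f hf => init_mem_strictWords_of_mem hf hm
  · exact key (n + 1) le_rfl (fun h => absurd h hm) fun f hf => init_mem_strictWords hf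

theorem wordSum_mem_supported (n m : ℕ) (A : Set ℕ) :
    wordSum n m A ∈ supported ℤ {j : ℕ | j < n} := by
  refine sum_mem fun f hf => prod_mem fun j _ => ?_
  rw [Set.Finite.mem_toFinset] at hf
  exact Algebra.subset_adjoin ⟨f j, hf.1 j, rfl⟩

theorem ins_wordSum_last (n m : ℕ) (A : Set ℕ) :
    ins (0 : ℤ) n (wordSum (n + 1) m A) = wordSum n m A := by
  cases m with
  | zero => rw [wordSum_zero_right, wordSum_zero_right, map_one]
  | succ m =>
    rw [wordSum_succ, map_add, map_mul, ins_X_self, C_0, zero_mul, zero_add,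
      ins_of_supported _ le_rfl (wordSum_mem_supported _ _ _)]

/-- Quasisymmetry at `t = 0`, by induction on the length and the alphabet. In the boundary case,
inserting `0` at `i` reproduces the recursion `wordSum_succ` for the alphabet of size `i + 1`. -/
theorem ins_wordSum_succ {n i : ℕ} (hi : i + 1 < n) (m : ℕ) (A : Set ℕ) :
    ins (0 : ℤ) (i + 1) (wordSum n m A) = ins 0 i (wordSum n m A) := by
  classical
  induction m generalizing n i with
  | zero => rw [wordSum_zero_right, map_one, map_one]
  | succ m ihm =>
    induction n with
    | zero => omega
    | succ n ihn =>
      rw [wordSum_succ, map_add, map_mul, map_add, map_mul]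
      rcases (Nat.lt_succ_iff.1 hi).lt_or_eq with h | rfl
      · rw [ihn h, ins_X_of_gt _ h, ins_X_of_gt _ (by omega)]
        split_ifs
        · rw [ihm h]
        · rw [ihm hi]
      · have h1 : ins (0 : ℤ) i (if m ∈ A then wordSum (i + 1) m A else wordSum (i + 1 + 1) m A) =
            if m ∈ A then wordSum i m A else wordSum (i + 1) m A := by
          split_ifs
          · exact ins_wordSum_last _ _ _
          · rw [← ihm (Nat.lt_succ_self _), ins_wordSum_last]
        rw [h1, ins_X_self, C_0, zero_mul, zero_add, ins_X_of_gt _ (Nat.lt_succ_self i),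
          ins_of_supported _ le_rfl (wordSum_mem_supported _ _ _), ins_wordSum_last,
          Nat.succ_sub_one, ← wordSum_succ]

theorem trimOp_wordSum_of_ne {n i : ℕ} (hi : i + 1 ≠ n) (m : ℕ) (A : Set ℕ) :
    trimOp (0 : ℤ) i (wordSum n m A) = 0 := by
  rcases hi.lt_or_gt with h | h
  · rw [trimOp_eq_zero_iff, ins_wordSum_succ h]
  · exact trimOp_of_supported _ (Nat.lt_succ_iff.1 h) (wordSum_mem_supported _ _ _)

-- The recursion read backwards: the top trimming deletes the last letter.
open Classical in
theorem trimOp_wordSum (n m : ℕ) (A : Set ℕ) :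
    trimOp (0 : ℤ) n (wordSum (n + 1) (m + 1) A) =
      if m ∈ A then wordSum n m A else wordSum (n + 1) m A := by
  apply trimOp_eq_of_mul_eq
  rw [ins_wordSum_last, ins_of_supported _ le_rfl (wordSum_mem_supported _ _ _), wordSum_succ, C_0]
  ring

theorem aeval_wordSum (n m : ℕ) (A : Set ℕ) :
    aeval (0 : ℕ → ℤ) (wordSum n (m + 1) A) = 0 := by
  rw [wordSum, map_sum]
  refine Finset.sum_eq_zero fun f _ => ?_
  rw [map_prod]
  exact Finset.prod_eq_zero (Finset.mem_univ 0) (by simp)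

/-! ### Padded codes -/

/-- The codes of the form `0^m a_1 ⋯ a_{n-m} 0 0 0 ⋯` with all `a_i > 0`. -/
def IsPaddedCode (n : ℕ) (c : ℕ →₀ ℕ) : Prop :=
  ∃ m ≤ n, ∀ i, 0 < c i ↔ m ≤ i ∧ i < n

/-- The proper partial sums of a padded code. -/
def codeSums (n : ℕ) (c : ℕ →₀ ℕ) : Set ℕ :=
  {s | ∃ k, 0 < c k ∧ k + 1 < n ∧ s = ∑ j ∈ Finset.range (k + 1), c j}

/-- Padded codes are those without a descent other than `n - 1`: a positive entry forces positive
entries up to `n - 1`, and the last nonzero entry is itself a descent. -/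
theorem isPaddedCode_iff {n : ℕ} {c : ℕ →₀ ℕ} :
    IsPaddedCode n c ↔ ∀ i e, c = graft e i → i + 1 = n := by
  have h0 : (∀ i e, c = graft e i → i + 1 = n) ↔ ∀ i, 0 < c i → c (i + 1) = 0 → i + 1 = n := by
    refine forall_congr' fun i => ?_
    rw [← and_imp, ← exists_graft_iff, forall_exists_index]
  rw [h0]
  constructor
  · rintro ⟨m, hm, h⟩ i hi hi'
    have h1 := (h i).1 hi
    have h2 := (h (i + 1)).not.1 (by omega)
    omega
  · intro h
    classical
    have hstep : ∀ i k, 0 < c i → i + k < n → 0 < c (i + k) := by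
      intro i k hi
      induction k with
      | zero => intro _; exact hi
      | succ k ih =>
        intro hk
        by_contra hc
        have := h (i + k) (ih (by omega)) (by rw [add_assoc]; omega)
        omega
    have hlt : ∀ i, 0 < c i → i < n := by
      intro i hi
      by_contra hc
      obtain ⟨j, e, hj, he⟩ := exists_graft_of_ne_zero hi.ne'
      have h1 := (exists_graft_iff (c := c) (i := j)).1 ⟨e, he⟩
      have := h j h1.1 h1.2
      omega
    by_cases hc : ∃ i, 0 < c i
    · refine ⟨Nat.find hc, (hlt _ (Nat.find_spec hc)).le, fun i => ⟨fun hi =>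
        ⟨Nat.find_min' hc hi, hlt i hi⟩, fun ⟨h1, h2⟩ => ?_⟩⟩
      have := hstep _ (i - Nat.find hc) (Nat.find_spec hc) (by omega)
      rwa [Nat.add_sub_of_le h1] at this
    · refine ⟨n, le_rfl, fun i => ⟨fun hi => absurd ⟨i, hi⟩ hc, fun hi => ?_⟩⟩
      omega

theorem degree_eq_sum_range {n : ℕ} {c : ℕ →₀ ℕ} (h : ∀ i, n ≤ i → c i = 0) :
    c.degree = ∑ j ∈ Finset.range n, c j := by
  rw [Finsupp.degree_apply]
  refine Finset.sum_subset (fun i hi => ?_) fun i _ hi => Finsupp.notMem_support_iff.1 hi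
  rw [Finset.mem_range]
  by_contra hc
  exact Finsupp.mem_support_iff.1 hi (h i (not_lt.1 hc))

theorem IsPaddedCode.eq_zero_of_le {n : ℕ} {c : ℕ →₀ ℕ} (h : IsPaddedCode n c) {i : ℕ}
    (hi : n ≤ i) : c i = 0 := by
  obtain ⟨m, -, hm⟩ := h
  by_contra hc
  have := (hm i).1 (Nat.pos_of_ne_zero hc)
  omega

theorem sum_range_congr_of_lt {n : ℕ} {c c' : ℕ →₀ ℕ} (h : ∀ j < n, c' j = c j) {k : ℕ}
    (hk : k < n) : ∑ j ∈ Finset.range (k + 1), c' j = ∑ j ∈ Finset.range (k + 1), c j :=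
  Finset.sum_congr rfl fun j hj => h j (by have := Finset.mem_range.1 hj; omega)

/-- Induction on the word length. Trimming at `n - 1` lowers the last part by one; if the part
becomes zero, the alphabet shrinks, and this is the case `d ∈ A`. The set `A` stays fixed, so it is
compared with the partial sums only in the range `0 < s < d`. -/
theorem coeffFun_wordSum {d n : ℕ} {c : ℕ →₀ ℕ} {A : Set ℕ} (hc : IsPaddedCode n c)
    (hd : c.degree = d) (hA : ∀ s, 0 < s → s < d → (s ∈ A ↔ s ∈ codeSums n c)) (e : ℕ →₀ ℕ) :
    coeffFun (0 : ℕ → ℤ) e (wordSum n d A) = if e = c then 1 else 0 := by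
  induction d generalizing n c e with
  | zero => rw [wordSum_zero_right, coeffFun_one, (Finsupp.degree_eq_zero_iff c).1 hd]
  | succ d ih =>
    have hsum := degree_eq_sum_range (fun i hi => hc.eq_zero_of_le (i := i) hi)
    have hzig := isPaddedCode_iff.1 hc
    obtain ⟨i₀, u, rfl⟩ := (eq_zero_or_exists_graft c).resolve_left (by rintro rfl; simp at hd)
    obtain rfl := hzig i₀ u rfl
    rcases eq_zero_or_exists_graft e with rfl | ⟨i, e, rfl⟩
    · rw [coeffFun_zero, aeval_wordSum, if_neg (graft_ne_zero u i₀).symm]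
    rw [coeffFun_graft]
    change coeffFun (0 : ℕ → ℤ) e (trimOp 0 i (wordSum (i₀ + 1) (d + 1) A)) = _
    by_cases hi : i = i₀
    swap
    · rw [trimOp_wordSum_of_ne (by omega), map_zero, if_neg]
      intro h
      exact hi (Nat.succ_injective (hzig i e h.symm))
    subst hi
    have hinj : graft e i = graft u i ↔ e = u := (graft_injective i).eq_iff
    simp only [hinj, trimOp_wordSum]
    rw [Finset.sum_range_succ, graft_self] at hsum
    have hdu : u.degree = d := by rw [degree_graft] at hd; omega
    have hlow : ∀ j < i, u j = graft u i j := fun j hj => by rw [graft_apply, if_pos hj]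
    have hhigh : ∀ j, i < j → u j = 0 := by
      intro j hj
      have := hc.eq_zero_of_le (i := j + 1) (by omega)
      rwa [graft_apply, if_neg (by omega), if_neg (by omega), if_neg (by omega)] at this
    obtain ⟨m, hm, hpos⟩ := hc
    have hmi : m ≤ i := ((hpos i).1 (by rw [graft_self]; omega)).1
    rcases Nat.eq_zero_or_pos (u i) with hui | hui
    -- With no letters left, both branches of the recursion are `1`.
    · rcases Nat.eq_zero_or_pos d with rfl | hd0
      · rw [wordSum_zero_right, wordSum_zero_right, ite_self, coeffFun_one,
          (Finsupp.degree_eq_zero_iff u).1 hdu]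
      have hmlt : m < i := by
        by_contra hcon
        have h0 : ∑ j ∈ Finset.range i, graft u i j = 0 := by
          refine Finset.sum_eq_zero fun j hj => ?_
          have h1 := (hpos j).not
          have h2 := Finset.mem_range.1 hj
          have h3 := h1.2 (by omega)
          omega
        omega
      have hlast : ∑ j ∈ Finset.range i, graft u i j = d := by omega
      have hdA : d ∈ A := by
        rw [hA d hd0 (Nat.lt_succ_self d)]
        refine ⟨i - 1, (hpos _).2 (by omega), by omega, ?_⟩
        rw [Nat.sub_add_cancel (by omega), hlast]
      rw [if_pos hdA]
      refine ih ⟨m, hmi, fun j => ?_⟩ hdu (fun s hs hsd => ?_) e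
      · rcases lt_trichotomy j i with hj | rfl | hj
        · rw [hlow j hj, hpos]
          omega
        · omega
        · rw [hhigh j hj]
          omega
      · rw [hA s hs (by omega)]
        constructor
        · rintro ⟨k, hk, hki, rfl⟩
          -- For `k + 1 = i` the partial sum would be the whole of `d`, contrary to `s < d`.
          have hki' : k + 1 < i := by
            by_contra hcon
            obtain rfl : i = k + 1 := by omega
            omega
          exact ⟨k, by rwa [hlow k (by omega)], hki',
            (sum_range_congr_of_lt hlow (by omega)).symm⟩
        · rintro ⟨k, hk, hki, rfl⟩
          exact ⟨k, by rwa [← hlow k (by omega)], by omega,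
            sum_range_congr_of_lt hlow (by omega)⟩
    · have hle : ∀ k < i, ∑ j ∈ Finset.range (k + 1), graft u i j ≤
          ∑ j ∈ Finset.range i, graft u i j := fun k hk =>
        Finset.sum_le_sum_of_subset (Finset.range_mono (by omega))
      -- The last part is still positive, so every proper partial sum is smaller than `d`.
      have hdA : d ∉ A := by
        rw [hA d (by omega) (Nat.lt_succ_self d)]
        rintro ⟨k, hk, hki, hk'⟩
        have := hle k (by omega)
        omega
      rw [if_neg hdA]
      refine ih ⟨m, hm, fun j => ?_⟩ hdu (fun s hs hsd => ?_) e
      · rcases lt_trichotomy j i with hj | rfl | hj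
        · rw [hlow j hj, hpos]
        · omega
        · rw [hhigh j hj]
          omega
      · rw [hA s hs (by omega)]
        constructor
        · rintro ⟨k, hk, hki, rfl⟩
          exact ⟨k, by rwa [hlow k (by omega)], hki,
            (sum_range_congr_of_lt hlow (by omega)).symm⟩
        · rintro ⟨k, hk, hki, rfl⟩
          exact ⟨k, by rwa [← hlow k (by omega)], hki, sum_range_congr_of_lt hlow (by omega)⟩

/-- A finite sequence with zeros appended, as a finitely supported function. -/
def padCode {n : ℕ} (c : Fin n → ℕ) : ℕ →₀ ℕ :=
  Finsupp.ofSupportFinite (appendZeros c) ((Set.finite_lt_nat n).subset fun i hi => by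
    by_contra h
    exact hi (dif_neg h))

theorem coe_padCode {n : ℕ} (c : Fin n → ℕ) : ⇑(padCode c) = appendZeros c := rfl

theorem padCode_fin {n : ℕ} (c : Fin n → ℕ) (i : Fin n) : padCode c i = c i := by
  rw [coe_padCode, appendZeros, dif_pos i.isLt]

theorem padCode_of_le {n : ℕ} (c : Fin n → ℕ) {i : ℕ} (h : n ≤ i) : padCode c i = 0 := by
  rw [coe_padCode, appendZeros, dif_neg (not_lt.2 h)]

theorem padCode_injective {n : ℕ} : Function.Injective (padCode (n := n)) := by
  intro c c' h
  funext i
  rw [← padCode_fin c, h, padCode_fin]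

theorem isPaddedCode_padCode_iff {n : ℕ} {c : Fin n → ℕ} :
    IsPaddedCode n (padCode c) ↔ c ∈ padded n := by
  refine exists_congr fun m => and_congr_right fun _ => ⟨fun h i => ?_, fun h i => ?_⟩
  · rw [← padCode_fin c, h]
    simp
  · by_cases hi : i < n
    · have := h ⟨i, hi⟩
      rw [← padCode_fin c] at this
      simpa [hi] using this
    · rw [padCode_of_le c (not_lt.1 hi)]
      omega

theorem IsPaddedCode.exists_padCode {n : ℕ} {c : ℕ →₀ ℕ} (h : IsPaddedCode n c) :
    ∃ c' ∈ padded n, padCode c' = c := by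
  have h1 : padCode (fun i : Fin n => c i) = c := by
    ext i
    by_cases hi : i < n
    · exact padCode_fin _ ⟨i, hi⟩
    · rw [padCode_of_le _ (not_lt.1 hi), h.eq_zero_of_le (not_lt.1 hi)]
  exact ⟨_, isPaddedCode_padCode_iff.1 (h1.symm ▸ h), h1⟩

theorem degree_padCode {n : ℕ} (c : Fin n → ℕ) : (padCode c).degree = ∑ k, c k := by
  rw [degree_eq_sum_range fun i hi => padCode_of_le c hi, Finset.sum_range]
  simp only [padCode_fin]

theorem codeSums_padCode {n : ℕ} (c : Fin n → ℕ) : codeSums n (padCode c) = partialSums c := by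
  have key : ∀ k : Fin n, ∑ j ∈ Finset.range (k + 1), padCode c j = ∑ j ∈ Finset.Iic k, c j := by
    intro k
    symm
    refine Finset.sum_bij (fun j _ => (j : ℕ)) ?_ ?_ ?_ ?_
    · intro j hj
      rw [Finset.mem_Iic, Fin.le_def] at hj
      rw [Finset.mem_range]
      omega
    · intro a _ b _ h
      exact Fin.ext h
    · intro j hj
      rw [Finset.mem_range] at hj
      have := k.isLt
      refine ⟨⟨j, by omega⟩, ?_, rfl⟩
      rw [Finset.mem_Iic, Fin.le_def]
      exact Nat.lt_succ_iff.1 hj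
    · intro j _
      rw [padCode_fin]
  ext s
  constructor
  · rintro ⟨k, hk, hkn, rfl⟩
    exact ⟨⟨k, by omega⟩, by rwa [← padCode_fin c], hkn, key ⟨k, by omega⟩⟩
  · rintro ⟨k, hk, hkn, rfl⟩
    exact ⟨k, by rwa [padCode_fin], hkn, (key k).symm⟩

theorem fundamental_eq_wordSum {n : ℕ} (c : Fin n → ℕ) :
    fundamental c = wordSum n (∑ k, c k) (partialSums c) := by
  rw [fundamental, wordSum]
  refine Finset.sum_bij (fun f _ j => (f j : ℕ)) ?_ ?_ ?_ fun _ _ => rfl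
  · intro f hf
    rw [Set.Finite.mem_toFinset]
    simp only [Finset.mem_filter, Finset.mem_univ, true_and] at hf
    exact ⟨fun j => (f j).isLt, hf.1, hf.2⟩
  · intro f _ g _ h
    funext j
    exact Fin.ext (congrFun h j)
  · intro g hg
    rw [Set.Finite.mem_toFinset] at hg
    refine ⟨fun j => ⟨g j, hg.1 j⟩, ?_, rfl⟩
    simp only [Finset.mem_filter, Finset.mem_univ, true_and]
    exact hg.2

theorem coeffFun_fundamental {n : ℕ} {c : Fin n → ℕ} (hc : c ∈ padded n) (e : ℕ →₀ ℕ) :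
    coeffFun (0 : ℕ → ℤ) e (fundamental c) = if e = padCode c then 1 else 0 := by
  rw [fundamental_eq_wordSum]
  exact coeffFun_wordSum (isPaddedCode_padCode_iff.2 hc) (degree_padCode c)
    (fun s _ _ => by rw [codeSums_padCode]) e

theorem specializeZero_codePoly {n : ℕ} {c : Fin n → ℕ} (hc : c ∈ padded n) :
    specializeZero (codePoly (padCode c)) = fundamental c := by
  refine eq_of_coeffFun (0 : ℕ → ℤ) fun e => ?_
  have h := map_coeffFun (eval fun _ => (0 : ℤ)) tvar e (codePoly (padCode c))
  have h0 : (fun i => eval (fun _ => (0 : ℤ)) (tvar i)) = 0 := by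
    funext i
    simp [tvar]
  rw [h0, coeffFun_codePoly] at h
  rw [coeffFun_fundamental hc, specializeZero, ← h]
  split_ifs <;> simp

/-! ### The family of double forest polynomials -/

/-- Renaming `t` past index `i` carries the alphabet `tvar` to the one left after trimming at `i`.
-/
theorem coeffFun_omitT (i : ℕ) (e : ℕ →₀ ℕ) (f : PolyTX) :
    coeffFun (tvar ∘ skip i) e (omitT i f) =
      rename (fun j => if j < i then j else j + 1) (coeffFun tvar e f) := by
  have h := map_coeffFun
    (rename (fun j => if j < i then j else j + 1) : CoeffT →ₐ[ℤ] CoeffT).toRingHom tvar e f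
  have h0 : (fun j => (rename (fun j => if j < i then j else j + 1) :
      CoeffT →ₐ[ℤ] CoeffT).toRingHom (tvar j)) = tvar ∘ skip i := by
    funext j
    simp [tvar, skip]
  rw [h0] at h
  exact h.symm

open IndexedForest in
theorem eq_graft_iff_of_mem_qdes {F : IndexedForest} {i : ℕ} (hi : i ∈ F.qdes) (e : ℕ →₀ ℕ) :
    graft e i = F.finCode ↔ e = (F.trim i).finCode := by
  obtain ⟨u, hu⟩ := mem_qdes_iff_exists_graft.1 hi
  rw [finCode_trim hi, hu, prune_graft]
  exact (graft_injective i).eq_iff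

theorem coeffFun_eope (i : ℕ) (e : ℕ →₀ ℕ) (f : PolyTX) :
    coeffFun (tvar ∘ skip i) e (eope i f) = coeffFun tvar (graft e i) f := by
  rw [eope_eq_trimOp, coeffFun_graft]

theorem isDoubleForestFamily_codePoly :
    IsDoubleForestFamily fun F => codePoly F.finCode where
  homogeneous F := ⟨_, homogTX_codePoly F.finCode⟩
  normalized_empty := by
    rw [evalXT, ← coeffFun_zero, coeffFun_codePoly, IndexedForest.finCode_empty, if_pos rfl]
  normalized F hF := by
    rw [evalXT, ← coeffFun_zero, coeffFun_codePoly, if_neg]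
    exact fun h => hF (IndexedForest.finCode_eq_zero_iff.1 h.symm)
  eope_of_mem F i hi := by
    refine eq_of_coeffFun (tvar ∘ skip i) fun e => ?_
    rw [coeffFun_eope, coeffFun_omitT, coeffFun_codePoly, coeffFun_codePoly]
    simp only [eq_graft_iff_of_mem_qdes hi]
    split_ifs <;> simp
  eope_of_notMem F i hi := by
    refine eq_zero_of_coeffFun (tvar ∘ skip i) fun e => ?_
    rw [coeffFun_eope, coeffFun_codePoly, if_neg]
    exact fun h => hi (IndexedForest.mem_qdes_iff_exists_graft.2 ⟨e, h.symm⟩)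

/-- The recursion and the normalization determine every functional, by induction on its code;
separation then gives uniqueness of the family. -/
theorem IsDoubleForestFamily.coeffFun {P : IndexedForest → PolyTX} (hP : IsDoubleForestFamily P)
    (F : IndexedForest) (e : ℕ →₀ ℕ) :
    coeffFun tvar e (P F) = if e = F.finCode then 1 else 0 := by
  induction e using graft_induction generalizing F with
  | h0 =>
    rw [coeffFun_zero]
    by_cases hF : F = IndexedForest.empty
    · rw [hF, IndexedForest.finCode_empty, if_pos rfl]
      exact hP.normalized_empty
    · rw [if_neg fun h => hF (IndexedForest.finCode_eq_zero_iff.1 h.symm)]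
      exact hP.normalized F hF
  | h e i ih =>
    rw [← coeffFun_eope]
    by_cases hi : i ∈ F.qdes
    · rw [hP.eope_of_mem F i hi, coeffFun_omitT, ih]
      simp only [eq_graft_iff_of_mem_qdes hi]
      split_ifs <;> simp
    · rw [hP.eope_of_notMem F i hi, map_zero, if_neg]
      exact fun h => hi (IndexedForest.mem_qdes_iff_exists_graft.2 ⟨e, h.symm⟩)

theorem IsDoubleForestFamily.eq_codePoly {P : IndexedForest → PolyTX}
    (hP : IsDoubleForestFamily P) (F : IndexedForest) : P F = codePoly F.finCode :=
  eq_of_coeffFun tvar fun e => by rw [hP.coeffFun, coeffFun_codePoly]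

theorem doubleForest_eq (F : IndexedForest) : doubleForest F = codePoly F.finCode :=
  IsDoubleForestFamily.eq_codePoly (Classical.epsilon_spec ⟨_, isDoubleForestFamily_codePoly⟩) F

theorem existsUnique_code_eq {n : ℕ} (c : Fin n → ℕ) :
    ∃! F : IndexedForest, F.code = appendZeros c := by
  obtain ⟨F, hF⟩ := IndexedForest.finCode_surjective (padCode c)
  have hF' : F.code = appendZeros c := by rw [← IndexedForest.coe_finCode, hF, coe_padCode]
  exact ⟨F, hF', fun G hG => IndexedForest.code_injective (hG.trans hF'.symm)⟩

theorem finCode_forestOf {n : ℕ} (c : Fin n → ℕ) : (forestOf c).finCode = padCode c :=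
  DFunLike.coe_injective (Classical.epsilon_spec (existsUnique_code_eq c).exists :
    (forestOf c).code = appendZeros c)

theorem doubleFundamental_eq {n : ℕ} (c : Fin n → ℕ) :
    doubleFundamental c = codePoly (padCode c) := by
  rw [doubleFundamental, doubleForest_eq, finCode_forestOf]

theorem mem_zigzag_iff {n : ℕ} {F : IndexedForest} :
    F ∈ zigzag n ↔ IsPaddedCode n F.finCode := by
  rw [isPaddedCode_iff]
  refine forall_congr' fun i => ?_
  rw [IndexedForest.mem_qdes_iff_exists_graft, forall_exists_index]

theorem image_doubleForest_zigzag (n : ℕ) :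
    doubleForest '' zigzag n = doubleFundamental '' padded n := by
  ext f
  constructor
  · rintro ⟨F, hF, rfl⟩
    obtain ⟨c, hc, hc'⟩ := (mem_zigzag_iff.1 hF).exists_padCode
    exact ⟨c, hc, by rw [doubleFundamental_eq, doubleForest_eq, hc']⟩
  · rintro ⟨c, hc, rfl⟩
    refine ⟨forestOf c, ?_, rfl⟩
    rw [mem_zigzag_iff, finCode_forestOf]
    exact isPaddedCode_padCode_iff.2 hc

/-! ### Bases of the equivariantly quasisymmetric polynomials -/

/-- Vanishing for `i ≥ n` encodes the restriction to `n` variables, and vanishing for `i + 1 < n`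
encodes quasisymmetry. For `n = 0` no index is excluded. -/
theorem mem_eqsym_iff {n : ℕ} {f : PolyTX} :
    f ∈ eqsym n ↔ ∀ i, i + 1 ≠ n → trimOp (tvar i) i f = 0 := by
  constructor
  · rintro ⟨h1, h2⟩ i hi
    rcases hi.lt_or_gt with h | h
    · rw [trimOp_eq_zero_iff, ← rPlus_eq, ← rMinus_eq]
      exact h2 i h
    · exact trimOp_of_supported _ (Nat.lt_succ_iff.1 h) h1
  · intro h
    refine ⟨mem_supported_of_trimOp tvar n fun i hi => h i (by omega), fun i hi => ?_⟩
    rw [rPlus_eq, rMinus_eq, ← trimOp_eq_zero_iff]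
    exact h i hi.ne

theorem codePoly_mem_eqsym {n : ℕ} {c : ℕ →₀ ℕ} (hc : IsPaddedCode n c) :
    codePoly c ∈ eqsym n := by
  rw [mem_eqsym_iff]
  intro i hi
  refine eq_zero_of_coeffFun (tvar ∘ skip i) fun e => ?_
  rw [← coeffFun_graft, coeffFun_codePoly, if_neg]
  exact fun h => hi (isPaddedCode_iff.1 hc i e h.symm)

/-- At any descent `i` of the code the coefficient factors through `E_i f`. -/
theorem isPaddedCode_of_coeffFun_ne_zero {n : ℕ} {f : PolyTX} (hf : f ∈ eqsym n) {c : ℕ →₀ ℕ}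
    (h : coeffFun tvar c f ≠ 0) : IsPaddedCode n c := by
  rw [isPaddedCode_iff]
  rintro i e rfl
  by_contra hi
  rw [coeffFun_graft, mem_eqsym_iff.1 hf i hi, map_zero] at h
  exact h rfl

theorem coeffFun_sum_smul_codePoly {ι : Type*} {κ : ι → (ℕ →₀ ℕ)} (hκ : Function.Injective κ)
    (s : Finset ι) (a : ι → CoeffT) (x : ι) (hx : x ∉ s → a x = 0) :
    coeffFun tvar (κ x) (∑ y ∈ s, a y • codePoly (κ y)) = a x := by
  classical
  have hterm : ∀ y ∈ s, coeffFun tvar (κ x) (a y • codePoly (κ y)) = if x = y then a y else 0 := by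
    intro y _
    rw [map_smul, coeffFun_codePoly, smul_eq_mul]
    simp only [hκ.eq_iff, mul_ite, mul_one, mul_zero]
  rw [map_sum, Finset.sum_congr rfl hterm, Finset.sum_ite_eq]
  split_ifs with h
  · rfl
  · exact (hx h).symm

/-- Duality gives independence, and separation makes the finite sum of coefficients times `codePoly`
equal to `f`. The parametrization `κ` is left free to cover both zigzag forests and padded
compositions. -/
theorem exists_basis_eqsym {n : ℕ} {ι : Type*} {κ : ι → (ℕ →₀ ℕ)} (hκ : Function.Injective κ)
    (hrange : ∀ c, IsPaddedCode n c ↔ ∃ x, κ x = c) :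
    ∃ b : Module.Basis ι CoeffT (eqsym n), ∀ x, (b x : PolyTX) = codePoly (κ x) := by
  let v : ι → eqsym n := fun x => ⟨codePoly (κ x), codePoly_mem_eqsym ((hrange _).2 ⟨x, rfl⟩)⟩
  have hcoe : ∀ (s : Finset ι) (a : ι → CoeffT),
      ((∑ x ∈ s, a x • v x : eqsym n) : PolyTX) = ∑ x ∈ s, a x • codePoly (κ x) := by
    intro s a
    rw [AddSubmonoidClass.coe_finsetSum]
    rfl
  have hli : LinearIndependent CoeffT v := by
    rw [linearIndependent_iff'ₛ]
    intro s a a' h x hx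
    rw [← coeffFun_sum_smul_codePoly hκ s a x (absurd hx), ← hcoe, h, hcoe,
      coeffFun_sum_smul_codePoly hκ s a' x (absurd hx)]
  have hsp : ⊤ ≤ Submodule.span CoeffT (Set.range v) := by
    rintro ⟨f, hf⟩ -
    set s : Finset ι := (finite_coeffFun_ne_zero tvar f).toFinset.preimage κ hκ.injOn with hs
    have hsum : (⟨f, hf⟩ : eqsym n) = ∑ x ∈ s, coeffFun tvar (κ x) f • v x := by
      apply Subtype.ext
      rw [hcoe]
      refine eq_of_coeffFun tvar fun e => ?_
      by_cases he : IsPaddedCode n e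
      · obtain ⟨x, rfl⟩ := (hrange e).1 he
        rw [coeffFun_sum_smul_codePoly hκ s (fun y => coeffFun tvar (κ y) f) x]
        intro hx
        by_contra h
        exact hx (by simpa [hs] using h)
      -- At a code that is not padded, both sides vanish merely because they lie in `eqsym n`.
      · have h1 : ∀ g ∈ eqsym n, coeffFun tvar e g = 0 := fun g hg => by
          by_contra h
          exact he (isPaddedCode_of_coeffFun_ne_zero hg h)
        rw [h1 f hf, ← hcoe, h1 _ (Subtype.property _)]
    rw [hsum]
    exact sum_mem fun x _ => Submodule.smul_mem _ _ (Submodule.subset_span ⟨x, rfl⟩)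
  refine ⟨Module.Basis.mk hli hsp, fun x => ?_⟩
  rw [Module.Basis.mk_apply]

theorem exists_basis_zigzag (n : ℕ) : ∃ b : Module.Basis (zigzag n) CoeffT (eqsym n),
    ∀ F : zigzag n, (b F : PolyTX) = doubleForest F := by
  obtain ⟨b, hb⟩ := exists_basis_eqsym (n := n) (κ := fun F : zigzag n => F.1.finCode)
    (IndexedForest.finCode_injective.comp Subtype.val_injective) fun c => ⟨fun hc => by
      obtain ⟨F, rfl⟩ := IndexedForest.finCode_surjective c
      exact ⟨⟨F, mem_zigzag_iff.2 hc⟩, rfl⟩, by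
      rintro ⟨F, rfl⟩
      exact mem_zigzag_iff.1 F.2⟩
  exact ⟨b, fun F => by rw [hb, doubleForest_eq]⟩

theorem exists_basis_padded (n : ℕ) : ∃ b : Module.Basis (padded n) CoeffT (eqsym n),
    ∀ c : padded n, (b c : PolyTX) = doubleFundamental (c : Fin n → ℕ) := by
  obtain ⟨b, hb⟩ := exists_basis_eqsym (n := n) (κ := fun c : padded n => padCode c.1)
    (padCode_injective.comp Subtype.val_injective) fun c => ⟨fun hc => by
      obtain ⟨c', hc', h⟩ := hc.exists_padCode
      exact ⟨⟨c', hc'⟩, h⟩, by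
      rintro ⟨c, rfl⟩
      exact isPaddedCode_padCode_iff.2 c.2⟩
  exact ⟨b, fun c => by rw [hb, doubleFundamental_eq]⟩

end EQSymPoly

end

open EQSymPoly
theorem theorem4p9 :
    (∃! P : IndexedForest → PolyTX, IsDoubleForestFamily P) ∧
    ∀ n : ℕ,
      (∀ c ∈ padded n, ∃! F : IndexedForest, F.code = appendZeros c) ∧
      (∀ c ∈ padded n, specializeZero (doubleFundamental c) = fundamental c) ∧
      doubleForest '' zigzag n = doubleFundamental '' padded n ∧
      (∃ b : Module.Basis (zigzag n) CoeffT (eqsym n),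
        ∀ F : zigzag n, (b F : PolyTX) = doubleForest F) ∧
      (∃ b : Module.Basis (padded n) CoeffT (eqsym n),
        ∀ c : padded n, (b c : PolyTX) = doubleFundamental (c : Fin n → ℕ)) :=
  ⟨⟨_, isDoubleForestFamily_codePoly, fun _ hP => funext hP.eq_codePoly⟩, fun n =>
    ⟨fun c _ => existsUnique_code_eq c,
      fun c hc => by rw [doubleFundamental_eq, specializeZero_codePoly hc],
      image_doubleForest_zigzag n, exists_basis_zigzag n, exists_basis_padded n⟩⟩
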